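/- A directed graph has a finite vertex set $V$ and an edge set $E\subseteq V\times V$; $In(G)$ and $Out(G)$ are the sets of vertices of in-degree $0$ and of out-degree $0$. A legal dag is a directed graph $G=(V,E)$ without directed cycles, with $E\neq\emptyset$, in which every vertex of $In(G)$ has out-degree $1$, every vertex of $Out(G)$ has in-degree $1$, and $d_{in}(v)=d_{out}(v)$ for every other vertex $v$. The components of a directed graph are the connected components of its underlying undirected graph; a cluster is a subgraph consisting of one or more components. For $E'\subseteq E$, the graph $G_{E'}$ is obtained from $G$ by replacing each edge $e=(a,b)\in E'$ by the two edges $(a,x_e)$ and $(y_e,b)$, where $x_e,y_e$ are new, pairwise distinct vertices. It is acceptable if each of its components contains a directed path from a vertex of $In(G)$ to a vertex of $Out(G)$. For a legal dag $G$ and integers $k,\alpha\ge 1$, $\beta\ge 0$, the problem $GD(G,k,\alpha,\beta)$ asks whether there is $E'\subseteq E$ with $|E'|\le\beta$ such that $G_{E'}$ is acceptable and can be partitioned into clusters $G_1,\dots,G_p$, $p\le\alpha$, with $|In(G_i)|=|Out(G_i)|\le k$ for all $1\le i\le p$. Theorem. For every constant $\beta\ge 0$, there is a polynomial-time Turing machine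 that, given a connected legal dag $G$ (by its adjacency matrix) and integers $k,\alpha\ge 1$ (in binary), decides $GD(G,k,\alpha,\beta)$. More generally, for all constants $\beta\ge 0$ and $c$, there is a polynomial-time Turing machine that decides $GD(G,k,\alpha,\beta)$ for all integers $k,\alpha\ge 1$ and all legal dags $G$ with at most $c$ components. -/

import Mathlib

/-! ## Directed graphs

A directed graph is a `Digraph V`; below `V` is always a finite type. -/

namespace GraphDuplication

/-- The number of edges entering `v`. -/
noncomputable def inDegree {V : Type*} (G : Digraph V) (v : V) : ℕ :=
  {u : V | G.Adj u v}.ncard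

/-- The number of edges leaving `v`. -/
noncomputable def outDegree {V : Type*} (G : Digraph V) (v : V) : ℕ :=
  {u : V | G.Adj v u}.ncard

/-- `In(G)`: the vertices of in-degree `0`. -/
def inputs {V : Type*} (G : Digraph V) : Set V := {v | inDegree G v = 0}

/-- `Out(G)`: the vertices of out-degree `0`. -/
def outputs {V : Type*} (G : Digraph V) : Set V := {v | outDegree G v = 0}

/-- No directed cycles (in particular, no loops). -/
def IsDag {V : Type*} (G : Digraph V) : Prop := ∀ v, ¬ Relation.TransGen G.Adj v v

/-- Legal dags. -/
structure IsLegal {V : Type*} (G : Digraph V) : Prop where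
  isDag : IsDag G
  edges_nonempty : ∃ a b, G.Adj a b
  outDegree_input : ∀ v ∈ inputs G, outDegree G v = 1
  inDegree_output : ∀ v ∈ outputs G, inDegree G v = 1
  inDegree_eq_outDegree : ∀ v, v ∉ inputs G ∪ outputs G → inDegree G v = outDegree G v

/-- The components of `G`: the connected components of its underlying undirected graph. -/
abbrev Component {V : Type*} (G : Digraph V) : Type _ :=
  G.toSimpleGraphInclusive.ConnectedComponent

/-- A connected dag: the underlying undirected graph is connected. -/
def IsConnected {V : Type*} (G : Digraph V) : Prop := G.toSimpleGraphInclusive.Connected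

/-! ## Duplication of edges -/

/-- The graph `G_S` obtained from `G` by duplicating the edges in `S`: every edge
`e = (a, b)` in `S` is deleted and replaced by `(a, x_e)` and `(y_e, b)`, where
`x_e = Sum.inr (Sum.inl e)` and `y_e = Sum.inr (Sum.inr e)` are new vertices. -/
def duplicate {V : Type*} (G : Digraph V) (S : Finset (V × V)) :
    Digraph (V ⊕ (S ⊕ S)) where
  Adj
    | Sum.inl a, Sum.inl b => G.Adj a b ∧ (a, b) ∉ S
    | Sum.inl a, Sum.inr (Sum.inl e) => e.1.1 = a
    | Sum.inr (Sum.inr e), Sum.inl b => e.1.2 = b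
    | _, _ => False

/-- `G_S` is acceptable: each of its components contains a directed path (of `G_S`)
from a vertex of `In(G)` to a vertex of `Out(G)`. -/
def IsAcceptable {V : Type*} (G : Digraph V) (S : Finset (V × V)) : Prop :=
  ∀ c : Component (duplicate G S), ∃ a ∈ inputs G, ∃ b ∈ outputs G,
    (duplicate G S).toSimpleGraphInclusive.connectedComponentMk (Sum.inl a) = c ∧
      Relation.ReflTransGen (duplicate G S).Adj (Sum.inl a) (Sum.inl b)

/-- The subgraph of `H` that consists of the components in `C`. -/
def cluster {V : Type*} (H : Digraph V) (C : Set (Component H)) :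
    Digraph {v : V // H.toSimpleGraphInclusive.connectedComponentMk v ∈ C} where
  Adj a b := H.Adj a.1 b.1

/-- The question of the Graph Duplication problem `GD(G, k, α, β)`: is there a set `S` of at
most `β` edges such that `G_S` is acceptable and its components can be partitioned into at most
`α` (nonempty) clusters, each with equally many inputs and outputs, and at most `k` of them? -/
def HasSolution {V : Type*} (G : Digraph V) (k α β : ℕ) : Prop :=
  ∃ S : Finset (V × V), (∀ e ∈ S, G.Adj e.1 e.2) ∧ S.card ≤ β ∧ IsAcceptable G S ∧
    ∃ P : Set (Set (Component (duplicate G S))), Setoid.IsPartition P ∧ P.ncard ≤ α ∧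
      ∀ C ∈ P,
        (inputs (cluster (duplicate G S) C)).ncard =
          (outputs (cluster (duplicate G S) C)).ncard ∧
        (inputs (cluster (duplicate G S) C)).ncard ≤ k

/-! ## Instances, their encoding, and polynomial time -/

/-- An instance of the Graph Duplication problem with a fixed cut budget: a legal dag, on the
vertices `0, …, n - 1`, and integers `k, α ≥ 1`. -/
structure Instance where
  n : ℕ
  G : Digraph (Fin n)
  k : ℕ
  α : ℕ
  legal : IsLegal G
  one_le_k : 1 ≤ k
  one_le_α : 1 ≤ α

open Classical in
/-- The adjacency matrix of `G`, row by row, as a list of `n * n` bits. -/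
noncomputable def adjacencyBits {n : ℕ} (G : Digraph (Fin n)) : List Bool :=
  (List.finRange n).flatMap fun i => (List.finRange n).map fun j => decide (G.Adj i j)

/-- The input word of an instance, over the alphabet `Option Bool` of the two bits and a
separator `none`: the numbers `n`, `k`, `α` in binary, each followed by a separator, and then
the adjacency matrix of the graph. -/
noncomputable def Instance.encode (I : Instance) : List (Option Bool) :=
  (Computability.encodeNat I.n).map some ++ none ::
    ((Computability.encodeNat I.k).map some ++ none ::
      ((Computability.encodeNat I.α).map some ++ none ::
        (adjacencyBits I.G).map some))

open Classical in
/-- Some Turing machine decides in polynomial time (in the length of the input word), on all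
instances that satisfy `D`, whether they satisfy `Q`. -/
def PolyTimeDecidableOn (D Q : Instance → Prop) : Prop :=
  Nonempty (Turing.TM2ComputableInPolyTime (fun I : {I : Instance // D I} => I.1.encode)
    Computability.encodeBool (fun I : {I : Instance // D I} => decide (Q I.1)))

theorem separator_cancel {a b : List Bool} {s t : List (Option Bool)}
    (h : a.map some ++ none :: s = b.map some ++ none :: t) : a = b ∧ s = t := by
  induction a generalizing b with
  | nil => cases b <;> simp_all
  | cons x a ih =>
    cases b with
    | nil => simp_all
    | cons y b =>
      simp only [List.map_cons, List.cons_append, List.cons.injEq, Option.some.injEq] at h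
      obtain ⟨h1, h2⟩ := ih h.2
      exact ⟨by rw [h.1, h1], h2⟩

theorem adjacencyBits_injective {n : ℕ} :
    Function.Injective (adjacencyBits : Digraph (Fin n) → List Bool) := by
  classical
  intro G H h
  have key : ∀ l : List (Fin n),
      (l.flatMap fun i => (List.finRange n).map fun j => decide (G.Adj i j)) =
        (l.flatMap fun i => (List.finRange n).map fun j => decide (H.Adj i j)) →
      ∀ i ∈ l, ∀ j, G.Adj i j ↔ H.Adj i j := by
    intro l
    induction l with
    | nil => simp
    | cons x l ih =>
      intro hl i hi j
      simp only [List.flatMap_cons] at hl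
      obtain ⟨h1, h2⟩ := List.append_inj hl (by simp)
      rcases List.mem_cons.1 hi with rfl | hi
      · have := (List.map_inj_left.1 h1) j (List.mem_finRange j)
        simpa using this
      · exact ih h2 i hi j
  ext i j
  refine key (List.finRange n) ?_ i (List.mem_finRange i) j
  unfold adjacencyBits at h
  convert h

/-- Different instances have different input words. -/
theorem Instance.encode_injective : Function.Injective Instance.encode := by
  have nat_inj : Function.Injective Computability.encodeNat :=
    Function.LeftInverse.injective Computability.decode_encodeNat
  rintro ⟨n, G, k, α, _, _, _⟩ ⟨n', G', k', α', _, _, _⟩ h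
  simp only [Instance.encode] at h
  obtain ⟨h1, e1⟩ := separator_cancel h
  obtain ⟨h2, e2⟩ := separator_cancel e1
  obtain ⟨h3, e3⟩ := separator_cancel e2
  obtain rfl := nat_inj h1
  obtain rfl := nat_inj h2
  obtain rfl := nat_inj h3
  obtain rfl := adjacencyBits_injective ((Option.some_injective Bool).list_map e3)
  rfl

end GraphDuplication

/-!
For constant `β` and a constant bound `c` on the number of components, brute force is polynomial.
Cutting at most `β` edges leaves at most `c + 2 * β` components: every vertex stays linked to a
representative of its old component or to an end of a cut edge (`exists_representatives`). Hence
a solution is described by boundedly many vertices, namely the ends of the cut edges, a sequence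
`m` of representatives that meets all components, and for each `m i` the name `l i` of its cluster,
again a vertex. `IsCertificate` collects the conditions on these vertices. They concern the graph on
the original vertices with the cut edges deleted, since the new vertices of `duplicate G S` are
pendant (`comp_eq_comp`, `reflTransGen_duplicate`) and can be accounted for by the cut edges
themselves (`ncard_inputs_cluster`). The equality of the numbers of inputs and outputs is not a
condition, because it holds for all clusters by summation of the degrees
(`ncard_inputs_eq_ncard_outputs`). The lemmas `hasSolution_of_isCertificate` and
`exists_isCertificate` show that there is a solution iff there is a certificate.

To check all candidates in polynomial time on a Turing machine, the search is written in a small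
language for square matrices of truth values: first-order formulas (`Fm`) with comparison of the
numbers of true cells, and commands (`Cmd`) with loops over the vertices. Every formula and command
runs in polynomial time (`Fm.runs`, `Cmd.runs`), since they are translated to structured stack
programs (`Prog`), and these, step by step, to the code of a `TM2` machine (`reachesIn_of_exec`).
The input is prepared by `Prog.init`: a number in binary becomes a matrix with as many true cells,
cut off at `n * n`, which no matrix size exceeds. Then `polyTimeDecidableOn_of_cmd` reduces the
theorem to the correctness of the search (`eval_searchCmd`). In it, reachability and linkage are
transitive closures (`Cmd.close`), and all conditions of `IsCertificate` are formulas about these.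
-/

namespace GraphDuplication

open Function Turing

/-! ### Structured programs on stacks -/

/-- The stack alphabet: the two bits `some b` and the separator `none`, as in the input words. -/
abbrev Sym : Type := Option Bool

/-- Structured programs on stacks indexed by `K`, with a single register that holds the result of
the last `pop` (`none` if the stack was empty). The command `loop k c p` pops the stack `k` into
the register and, as long as the register satisfies `c`, runs `p` and pops again; the symbol that
fails the test is removed too. -/
inductive Prog (K : Type) : Type
  | skip : Prog K
  | pop (k : K) : Prog K
  | push (k : K) (f : Option Sym → Sym) : Prog K
  | seq (p q : Prog K) : Prog K
  | ite (c : Option Sym → Bool) (p q : Prog K) : Prog K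
  | loop (k : K) (c : Option Sym → Bool) (p : Prog K) : Prog K

variable {K : Type} [DecidableEq K]

/-- `Exec p r s t r' s'`: the program `p`, started with register `r` and stacks `s`, stops after
exactly `t` steps with register `r'` and stacks `s'`. -/
inductive Exec : Prog K → Option Sym → (K → List Sym) → ℕ → Option Sym → (K → List Sym) → Prop
  | skip (r s) : Exec .skip r s 1 r s
  | pop (k r s) : Exec (.pop k) r s 1 (s k).head? (update s k (s k).tail)
  | push (k f r s) : Exec (.push k f) r s 1 r (update s k (f r :: s k))
  | seq {p q r s t r' s' t' r'' s''} : Exec p r s t r' s' → Exec q r' s' t' r'' s'' →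
      Exec (.seq p q) r s (t + t') r'' s''
  | ite_true {c p q r s t r' s'} : c r = true → Exec p r s t r' s' →
      Exec (.ite c p q) r s (1 + t) r' s'
  | ite_false {c p q r s t r' s'} : c r = false → Exec q r s t r' s' →
      Exec (.ite c p q) r s (1 + t) r' s'
  | loop_done {k c p s} (r) : c (s k).head? = false →
      Exec (.loop k c p) r s 1 (s k).head? (update s k (s k).tail)
  | loop_step {k c p s t r' s' t' r'' s''} (r) : c (s k).head? = true →
      Exec p (s k).head? (update s k (s k).tail) t r' s' →
      Exec (.loop k c p) r' s' t' r'' s'' → Exec (.loop k c p) r s (1 + (t + t')) r'' s''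

/-! ### Compilation to Turing machines -/

/-- The control points of a program; they become the labels of the machine. The extra point of
`ite` and `loop` is the one at which the test takes place. -/
def Prog.Pos : Prog K → Type
  | .skip => Unit
  | .pop _ => Unit
  | .push _ _ => Unit
  | .seq p q => p.Pos ⊕ q.Pos
  | .ite _ p q => Option (p.Pos ⊕ q.Pos)
  | .loop _ _ p => Option p.Pos

/-- A program has finitely many control points. -/
@[reducible]
noncomputable def Prog.fintypePos : (p : Prog K) → Fintype p.Pos
  | .skip => inferInstanceAs (Fintype Unit)
  | .pop _ => inferInstanceAs (Fintype Unit)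
  | .push _ _ => inferInstanceAs (Fintype Unit)
  | .seq p q => @instFintypeSum _ _ p.fintypePos q.fintypePos
  | .ite _ p q => @instFintypeOption _ (@instFintypeSum _ _ p.fintypePos q.fintypePos)
  | .loop _ _ p => @instFintypeOption _ p.fintypePos

/-- The control point at which a program starts. -/
def Prog.entry : (p : Prog K) → p.Pos
  | .skip => ()
  | .pop _ => ()
  | .push _ _ => ()
  | .seq p _ => Sum.inl p.entry
  | .ite _ _ _ => none
  | .loop _ _ _ => none

/-- The alphabets of the machine: besides the stacks of the program, all over `Sym`, there is an
output stack `none` over `Bool`. -/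
abbrev Alph : Option K → Type
  | none => Bool
  | some _ => Sym

/-- The machine code of a program whose control points are placed among the labels by `emb`, and
which jumps to the label `out` when it is done. -/
def Prog.code {Λ : Type} : (p : Prog K) → (p.Pos → Λ) → Λ → p.Pos →
    TM2.Stmt (Alph (K := K)) Λ (Option Sym)
  | .skip, _, out, _ => .goto fun _ => out
  | .pop k, _, out, _ => .pop (some k) (fun _ a => a) (.goto fun _ => out)
  | .push k f, _, out, _ => .push (some k) f (.goto fun _ => out)
  | .seq p q, emb, out, l =>
    match l with
    | Sum.inl a => p.code (fun i => emb (Sum.inl i)) (emb (Sum.inr q.entry)) a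
    | Sum.inr a => q.code (fun i => emb (Sum.inr i)) out a
  | .ite c p q, emb, out, l =>
    match l with
    | none => .branch c (.goto fun _ => emb (some (Sum.inl p.entry)))
        (.goto fun _ => emb (some (Sum.inr q.entry)))
    | some (Sum.inl a) => p.code (fun i => emb (some (Sum.inl i))) out a
    | some (Sum.inr a) => q.code (fun i => emb (some (Sum.inr i))) out a
  | .loop k c p, emb, out, l =>
    match l with
    | none => .pop (some k) (fun _ a => a)
        (.branch c (.goto fun _ => emb (some p.entry)) (.goto fun _ => out))
    | some a => p.code (fun i => emb (some i)) (emb none) a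

/-- The stacks of the machine when those of the program are `s` and the output is `o`. -/
def withOutput (s : K → List Sym) (o : List Bool) : ∀ k, List (Alph (K := K) k)
  | none => o
  | some k => s k

theorem update_withOutput (s : K → List Sym) (o : List Bool) (k : K) (l : List Sym) :
    update (withOutput s o) (some k) l = withOutput (update s k l) o := by
  funext j
  cases j with
  | none => simp [withOutput]
  | some j =>
    by_cases h : j = k
    · subst h; simp [withOutput]
    · simp [withOutput, h]

section Simulation

variable {Λ : Type} (m : Λ → TM2.Stmt (Alph (K := K)) Λ (Option Sym))

/-- The machine `m` gets from one configuration to another in exactly `t` steps. -/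
def ReachesIn (t : ℕ) (c d : TM2.Cfg (Alph (K := K)) Λ (Option Sym)) : Prop :=
  (flip bind (TM2.step m))^[t] (some c) = some d

theorem ReachesIn.trans {m : Λ → TM2.Stmt (Alph (K := K)) Λ (Option Sym)} {t t' c d e}
    (h : ReachesIn m t c d) (h' : ReachesIn m t' d e) : ReachesIn m (t + t') c e := by
  unfold ReachesIn at *
  rw [add_comm, iterate_add_apply, h, h']

theorem reachesIn_one {l : Λ} {r s d} (h : TM2.stepAux (m l) r s = d) :
    ReachesIn m 1 ⟨some l, r, s⟩ d := by
  simp [ReachesIn, flip, TM2.step, h]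

/-- Every step of a program is a single step of its machine code, so there is no overhead. -/
theorem reachesIn_of_exec {p : Prog K} {r s t r' s'} (h : Exec p r s t r' s') (emb : p.Pos → Λ)
    (out : Λ) (hm : ∀ a, m (emb a) = p.code emb out a) :
    ReachesIn m t ⟨some (emb p.entry), r, withOutput s []⟩ ⟨some out, r', withOutput s' []⟩ := by
  induction h generalizing out with
  | skip r s =>
    apply reachesIn_one
    simp [hm, Prog.code]
  | pop k r s =>
    apply reachesIn_one
    simp only [hm, Prog.code, TM2.stepAux, update_withOutput]
    rfl
  | push k f r s =>
    apply reachesIn_one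
    simp only [hm, Prog.code, TM2.stepAux, update_withOutput]
    rfl
  | @seq p q _ _ _ _ _ _ _ _ _ _ ih ih' =>
    exact (ih (fun i => emb (Sum.inl i)) _ fun a => hm (Sum.inl a)).trans
      (ih' (fun i => emb (Sum.inr i)) out fun a => hm (Sum.inr a))
  | ite_true hc _ ih =>
    refine ReachesIn.trans (reachesIn_one m ?_)
      (ih (fun i => emb (some (Sum.inl i))) out fun a => hm (some (Sum.inl a)))
    rw [hm, Prog.entry, Prog.code]
    simp [hc]
  | ite_false hc _ ih =>
    refine ReachesIn.trans (reachesIn_one m ?_)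
      (ih (fun i => emb (some (Sum.inr i))) out fun a => hm (some (Sum.inr a)))
    rw [hm, Prog.entry, Prog.code]
    simp [hc]
  | @loop_done k c p s r hc =>
    apply reachesIn_one
    rw [hm, Prog.entry, Prog.code]
    simp only [TM2.stepAux]
    rw [show c (withOutput s [] (some k)).head? = false from hc, update_withOutput]
    rfl
  | @loop_step k c p s _ _ _ _ _ _ r hc _ _ ih ih' =>
    refine (reachesIn_one m ?_).trans ((ih (fun i => emb (some i)) _ fun a => hm (some a)).trans
      (ih' emb out hm))
    rw [hm, Prog.entry, Prog.code]
    simp only [TM2.stepAux]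
    rw [show c (withOutput s [] (some k)).head? = true from hc, update_withOutput]
    rfl

end Simulation

/-- The Turing machine that runs `p`, with `k₀` as its input stack, and then outputs whether the
register holds the bit `true`. -/
noncomputable def Prog.machine [Fintype K] (p : Prog K) (k₀ : K) : FinTM2 where
  K := Option K
  k₀ := some k₀
  k₁ := none
  Γ := Alph
  Λ := Option p.Pos
  main := some p.entry
  ΛFin := @instFintypeOption _ p.fintypePos
  σ := Option Sym
  initialState := none
  Γk₀Fin := inferInstanceAs (Fintype Sym)
  m
    | none => .push none (fun r => decide (r = some (some true))) (.load (fun _ => none) .halt)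
    | some a => p.code some none a

/-- Programs that run in polynomial time and leave the answer in the register give polynomial-time
Turing machines. -/
theorem polyTimeDecidableOn_of_exec [Fintype K] {D Q : Instance → Prop} (p : Prog K) (k₀ : K)
    (T : Polynomial ℕ)
    (h : ∀ I : Instance, D I → ∃ t ≤ T.eval I.encode.length, ∃ b : Bool, (b = true ↔ Q I) ∧
      Exec p none (update (fun _ => []) k₀ I.encode) t (some (some b)) fun _ => []) :
    PolyTimeDecidableOn D Q := by
  classical
  refine ⟨{ tm := p.machine k₀, inputAlphabet := Equiv.refl _, outputAlphabet := Equiv.refl _,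
            time := T + 1, outputsFun := fun I => Nonempty.some ?_ }⟩
  obtain ⟨t, ht, b, hb, hp⟩ := h I.1 I.2
  have h1 := reachesIn_of_exec (p.machine k₀).m hp some none fun a => rfl
  have h2 := h1.trans (reachesIn_one (p.machine k₀).m rfl)
  have e1 : initList (p.machine k₀) I.1.encode =
      ⟨some (some p.entry), none, withOutput (update (fun _ => []) k₀ I.1.encode) []⟩ := by
    refine congrArg (TM2.Cfg.mk _ _) (funext fun k => ?_)
    cases k with
    | none => rfl
    | some k =>
      by_cases hk : k = k₀
      · subst hk
        simp [withOutput, Prog.machine]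
        rfl
      · simp [withOutput, Prog.machine, hk]
  have e2 : haltList (p.machine k₀) [b] =
      TM2.stepAux ((p.machine k₀).m none) (some (some b)) (withOutput (fun _ => []) []) := by
    refine congrArg (TM2.Cfg.mk _ _) (funext fun k => ?_)
    cases k with
    | none => cases b <;> rfl
    | some k => rfl
  refine ⟨⟨⟨t + 1, ?_⟩, ?_⟩⟩
  · rw [show decide (Q I.1) = b by rw [Bool.eq_iff_iff, hb, decide_eq_true_iff]]
    simp only [Equiv.refl]
    erw [List.map_id]
    unfold ReachesIn at h2
    exact (congrArg _ (congrArg some e1)).trans (Eq.trans h2 (congrArg some e2.symm))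
  · simpa using ht

end GraphDuplication

namespace GraphDuplication

open Function

/-! ### Running times of programs -/

section Runs

variable {K : Type} [DecidableEq K]

/-- Started with register `r` and stacks `s`, the program `p` stops after at most `T` steps with
stacks `s'`. -/
def Runs (p : Prog K) (r : Option Sym) (s : K → List Sym) (T : ℕ) (s' : K → List Sym) : Prop :=
  ∃ r' t, t ≤ T ∧ Exec p r s t r' s'

namespace Runs

theorem mono {p : Prog K} {r s T T' s'} (h : Runs p r s T s') (hT : T ≤ T') :
    Runs p r s T' s' := by
  obtain ⟨r', t, ht, h⟩ := h
  exact ⟨r', t, ht.trans hT, h⟩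

theorem conv {p : Prog K} {r s T T' s' s''} (h : Runs p r s T s') (hT : T ≤ T')
    (hs : ∀ k, s' k = s'' k) : Runs p r s T' s'' := by
  rw [← funext hs]
  exact h.mono hT

theorem seq {p q : Prog K} {r s T s' T' s''} (h : Runs p r s T s')
    (h' : ∀ r', Runs q r' s' T' s'') : Runs (.seq p q) r s (T + T') s'' := by
  obtain ⟨r', t, ht, h⟩ := h
  obtain ⟨r'', t', ht', h'⟩ := h' r'
  exact ⟨r'', t + t', add_le_add ht ht', .seq h h'⟩

theorem exec_seq {p q : Prog K} {r s t r' s' T s''} (h : Exec p r s t r' s')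
    (h' : Runs q r' s' T s'') : Runs (.seq p q) r s (t + T) s'' := by
  obtain ⟨r'', t', ht', h'⟩ := h'
  exact ⟨r'', t + t', by omega, .seq h h'⟩

theorem skip (r) (s : K → List Sym) : Runs .skip r s 1 s := ⟨_, _, le_rfl, .skip r s⟩

theorem pop (k : K) (r s) : Runs (.pop k) r s 1 (update s k (s k).tail) :=
  ⟨_, _, le_rfl, .pop k r s⟩

theorem push (k : K) (f r s) : Runs (.push k f) r s 1 (update s k (f r :: s k)) :=
  ⟨_, _, le_rfl, .push k f r s⟩

theorem pop_seq {k : K} {q r s T s''} (h : Runs q (s k).head? (update s k (s k).tail) T s'') :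
    Runs (.seq (.pop k) q) r s (1 + T) s'' := by
  obtain ⟨r', t, ht, h⟩ := h
  exact ⟨r', 1 + t, by omega, .seq (.pop k r s) h⟩

theorem push_seq {k : K} {f q r s T s''} (h : Runs q r (update s k (f r :: s k)) T s'') :
    Runs (.seq (.push k f) q) r s (1 + T) s'' := by
  obtain ⟨r', t, ht, h⟩ := h
  exact ⟨r', 1 + t, by omega, .seq (.push k f r s) h⟩

theorem ite {p q : Prog K} {c r s T s'} (hp : c r = true → Runs p r s T s')
    (hq : c r = false → Runs q r s T s') : Runs (.ite c p q) r s (1 + T) s' := by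
  cases h : c r with
  | true =>
    obtain ⟨r', t, ht, h'⟩ := hp h
    exact ⟨r', 1 + t, by omega, .ite_true h h'⟩
  | false =>
    obtain ⟨r', t, ht, h'⟩ := hq h
    exact ⟨r', 1 + t, by omega, .ite_false h h'⟩

theorem loop_done {k : K} {c p s} (r) (h : c (s k).head? = false) :
    Runs (.loop k c p) r s 1 (update s k (s k).tail) :=
  ⟨_, _, le_rfl, .loop_done r h⟩

theorem loop_step {k : K} {c p s T s' T' s''} (r) (hc : c (s k).head? = true)
    (h : Runs p (s k).head? (update s k (s k).tail) T s')
    (h' : ∀ r', Runs (.loop k c p) r' s' T' s'') : Runs (.loop k c p) r s (1 + (T + T')) s'' := by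
  obtain ⟨r', t, ht, h⟩ := h
  obtain ⟨r'', t', ht', h'⟩ := h' r'
  exact ⟨r'', 1 + (t + t'), by omega, .loop_step r hc h h'⟩

/-- The rule for loops: `S i` are the stacks before the `i`-th test. -/
theorem loop {k : K} {c p} (T j : ℕ) (S : ℕ → K → List Sym)
    (hS : ∀ i < j, ∃ b l, S i k = b :: l ∧ c (some b) = true ∧
      Runs p (some b) (update (S i) k l) T (S (i + 1)))
    (hc : c (S j k).head? = false) (r) :
    Runs (.loop k c p) r (S 0) (j * (T + 1) + 1) (update (S j) k (S j k).tail) := by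
  induction j generalizing S r with
  | zero => exact (loop_done r hc).mono (by omega)
  | succ j ih =>
    obtain ⟨b, l, h1, h2, h3⟩ := hS 0 (by omega)
    refine (loop_step r (by rw [h1]; exact h2) (by rw [h1]; exact h3)
      fun r' => ih (fun i => S (i + 1)) (fun i hi => hS (i + 1) (by omega)) hc r').mono ?_
    rw [Nat.succ_mul]
    omega

theorem loop_conv {k : K} {c p s s' T'} (T j : ℕ) (S : ℕ → K → List Sym)
    (hS : ∀ i < j, ∃ b l, S i k = b :: l ∧ c (some b) = true ∧
      Runs p (some b) (update (S i) k l) T (S (i + 1)))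
    (hc : c (S j k).head? = false) (hT : j * (T + 1) + 1 ≤ T') (h0 : ∀ k', s k' = S 0 k')
    (h1 : ∀ k', update (S j) k (S j k).tail k' = s' k') (r) :
    Runs (.loop k c p) r s T' s' := by
  rw [funext h0]
  exact (loop T j S hS hc r).conv hT h1

end Runs

/-- The symbol used for counting. -/
abbrev tok : Sym := some true

/-- The test for the symbol `tok`. -/
def isTok (r : Option Sym) : Bool := decide (r = some tok)

/-- The test for a bit. -/
def isBit (r : Option Sym) : Bool := r.join.isSome

@[simp] theorem isTok_some (b : Bool) : isTok (some (some b)) = b := by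
  cases b <;> rfl

@[simp] theorem isTok_sep : isTok (some none) = false := rfl

@[simp] theorem isTok_none : isTok none = false := rfl

@[simp] theorem isBit_some (b : Bool) : isBit (some (some b)) = true := rfl

@[simp] theorem isBit_sep : isBit (some none) = false := rfl

@[simp] theorem isBit_none : isBit none = false := rfl

/-- Push the register, or a separator if the register is empty. -/
def Prog.put (k : K) : Prog K := .push k fun r => r.getD none

/-- Move symbols from `src` to `dst`, as long as they satisfy `c`. -/
def Prog.move (src dst : K) (c : Option Sym → Bool) : Prog K := .loop src c (.put dst)

/-- Remove symbols from `k` as long as they satisfy `c`, and the next one. -/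
def Prog.drain (k : K) (c : Option Sym → Bool) : Prog K := .loop k c .skip

/-- The symbol that ends the move is removed from `src` and remains in the register. -/
theorem exec_move {src dst : K} {c} (hne : src ≠ dst) {s : K → List Sym} {l l' : List Sym}
    (hs : s src = l ++ l') (hl : ∀ b ∈ l, c (some b) = true) (hl' : c l'.head? = false) (r) :
    Exec (.move src dst c) r s (2 * l.length + 1) l'.head?
      (update (update s src l'.tail) dst (l.reverse ++ s dst)) := by
  induction l generalizing s r with
  | nil =>
    simp only [List.nil_append] at hs
    subst hs
    have h := Exec.loop_done (p := .put dst) r hl'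
    rwa [← update_eq_self dst (update s src _), update_of_ne hne.symm] at h
  | cons b l ih =>
    have h1 : (s src).head? = some b := by rw [hs]; rfl
    have h2 : (s src).tail = l ++ l' := by rw [hs]; rfl
    have h3 := ih (s := update (update s src (l ++ l')) dst (b :: s dst)) (by simp [hne])
      (fun b hb => hl b (by simp [hb])) (some b)
    have h4 := Exec.push dst (fun r => r.getD none) (some b) (update s src (l ++ l'))
    simp only [Option.getD_some, update_of_ne hne.symm] at h4
    rw [← h1, ← h2] at h4
    rw [← h1, ← h2] at h3
    have h5 := Exec.loop_step r (by rw [h1]; exact hl b (by simp)) h4 h3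
    refine (congrArg₂ (fun t s' => Exec (.move src dst c) r s t l'.head? s') ?_
      (funext fun k => ?_)).mp h5
    · simp only [List.length_cons]
      omega
    · simp only [update_apply]
      split_ifs <;> simp_all

theorem runs_move {src dst : K} {c} (hne : src ≠ dst) {s : K → List Sym} {l l' : List Sym}
    (hs : s src = l ++ l') (hl : ∀ b ∈ l, c (some b) = true) (hl' : c l'.head? = false) (r) :
    Runs (.move src dst c) r s (2 * l.length + 1)
      (update (update s src l'.tail) dst (l.reverse ++ s dst)) :=
  ⟨_, _, le_rfl, exec_move hne hs hl hl' r⟩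

theorem runs_drain {k : K} {c} {s : K → List Sym} {l l' : List Sym}
    (hs : s k = l ++ l') (hl : ∀ b ∈ l, c (some b) = true) (hl' : c l'.head? = false) (r) :
    Runs (.drain k c) r s (2 * l.length + 1) (update s k l'.tail) := by
  induction l generalizing s r with
  | nil =>
    simp only [List.nil_append] at hs
    refine (Runs.loop_done (s := s) (k := k) r (by rw [hs]; exact hl')).conv (by simp) fun k => ?_
    rw [hs]
  | cons b l ih =>
    have := ih (s := update s k (l ++ l')) (by simp) fun b hb => hl b (by simp [hb])
    refine (Runs.loop_step (s := s) (k := k) (T := 1) (s' := update s k (l ++ l')) r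
      (by rw [hs]; exact hl b (by simp)) ?_ fun r' => this r').conv (by simp; omega) fun k => ?_
    · rw [hs]
      exact Runs.skip _ _
    · simp

/-- Push as many symbols `tok` to `dst` as there are above the topmost separator of `src`, which
is restored by means of the auxiliary stack `t`. -/
def Prog.copy (t src dst : K) : Prog K :=
  .seq (.move src t isTok) (.seq (.push src fun _ => none)
    (.loop t isTok (.seq (.push src fun _ => tok) (.push dst fun _ => tok))))

theorem runs_copy {t src dst : K} (h1 : src ≠ t) (h2 : dst ≠ t) (h3 : src ≠ dst)
    {s : K → List Sym} {j : ℕ} {l : List Sym} (hs : s src = List.replicate j tok ++ none :: l)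
    (ht : s t = []) (r) :
    Runs (.copy t src dst) r s (5 * j + 3) (update s dst (List.replicate j tok ++ s dst)) := by
  have e1 := runs_move h1 hs (c := isTok) (by simp +contextual) rfl
  have e2 := Runs.loop (k := t) (c := isTok)
    (p := .seq (.push src fun _ => tok) (.push dst fun _ => tok)) 2 j
    (fun i => update (update (update s src (List.replicate i tok ++ none :: l)) t
      (List.replicate (j - i) tok)) dst (List.replicate i tok ++ s dst)) (fun i hi => ?_)
    (by simp [h2.symm])
  · refine (Runs.seq (e1 r) fun r' => Runs.push_seq (T := j * 3 + 1)
      (s'' := update s dst (List.replicate j tok ++ s dst)) ?_).mono (by simp; omega)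
    convert e2 r' using 1
    · funext k
      simp only [update_apply]
      split_ifs <;> simp_all
    · funext k
      simp only [update_apply]
      split_ifs <;> simp_all
  · refine ⟨tok, List.replicate (j - (i + 1)) tok, ?_, rfl, ?_⟩
    · simp only [update_apply, if_neg h2.symm, if_true]
      rw [← List.replicate_succ]
      congr 1
      omega
    · refine (Runs.push_seq (Runs.push _ _ _ _)).conv le_rfl fun k => ?_
      simp only [update_apply]
      split_ifs <;> simp_all [List.replicate_succ]

end Runs

end GraphDuplication

namespace GraphDuplication

open Function

/-! ### Access to the cells of a matrix -/

/-- The stacks of the programs that handle matrices. A number is a block of symbols `tok` on top of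
a separator: `n` holds the dimension, `v x` the value of the variable `x`, and `w x` the number of
iterations that a loop over `x` still has to make. The cells of the matrix `m` are on `a m`, row by
row. Results are left on `e`, the stack `z` is for binary numbers, and `p`, `u`, `t`, `r` are
auxiliary. -/
inductive Stk (X M : Type) : Type
  | v (x : X)
  | w (x : X)
  | a (m : M)
  | n
  | p
  | u
  | t
  | e
  | z
  | r
  deriving DecidableEq, Fintype

variable {X M : Type} [DecidableEq X] [DecidableEq M]

/-- The stack `n` holds the number `n`, and the auxiliary stacks are empty. -/
structure Clean (n : ℕ) (s : Stk X M → List Sym) : Prop where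
  n : s .n = List.replicate n tok ++ [none]
  p : s .p = []
  u : s .u = []
  t : s .t = []

/-- Replace a block of `i` symbols on `u` by a block of `i * n` symbols on `p`. -/
def Prog.rows : Prog (Stk X M) := .loop .u isTok (.copy .t .n .p)

theorem runs_rows {n i : ℕ} {s : Stk X M → List Sym} (hn : s .n = List.replicate n tok ++ [none])
    (ht : s .t = []) (hu : s .u = List.replicate i tok) (r) :
    Runs .rows r s (i * (5 * n + 4) + 1)
      (update (update s .u []) .p (List.replicate (i * n) tok ++ s .p)) := by
  refine Runs.loop_conv (5 * n + 3) i
    (fun j => update (update s .u (List.replicate (i - j) tok)) .p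
      (List.replicate (j * n) tok ++ s .p)) (fun j hj => ?_) (by simp) (by simp)
    (fun k => ?_) (fun k => ?_) r
  · refine ⟨tok, List.replicate (i - (j + 1)) tok, ?_, rfl, ?_⟩
    · simp only [update_apply]
      rw [← List.replicate_succ]
      simp
      omega
    · refine (runs_copy (j := n) (l := []) (by simp) (by simp) (by simp) (by simp [hn])
        (by simp [ht]) _).conv le_rfl fun k => ?_
      simp only [update_apply]
      split_ifs <;> simp_all [-List.replicate_append_replicate, Nat.succ_mul,
        Nat.add_comm (j * n) n, List.replicate_add]
  · simp only [update_apply]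
    split_ifs <;> simp_all
  · simp only [update_apply]
    split_ifs <;> simp_all

/-- Move as many cells of the matrix `m` to `t` as there are symbols on `p`. -/
def Prog.walk (m : M) : Prog (Stk X M) := .loop .p isTok (.seq (.pop (.a m)) (.put .t))

theorem runs_walk {k : ℕ} {m : M} {s : Stk X M → List Sym} (hp : s .p = List.replicate k tok)
    (ht : s .t = []) (hk : k ≤ (s (.a m)).length) (r) :
    Runs (.walk m) r s (k * 3 + 1) (update (update (update s .p []) (.a m) ((s (.a m)).drop k)) .t
      ((s (.a m)).take k).reverse) := by
  refine Runs.loop_conv 2 k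
    (fun j => update (update (update s .p (List.replicate (k - j) tok)) (.a m)
      ((s (.a m)).drop j)) .t ((s (.a m)).take j).reverse) (fun j hj => ?_) (by simp) (by simp)
    (fun k => ?_) (fun k => ?_) r
  · refine ⟨tok, List.replicate (k - (j + 1)) tok, ?_, rfl, ?_⟩
    · simp only [update_apply]
      rw [← List.replicate_succ]
      simp
      omega
    · have hj' : j < (s (.a m)).length := by omega
      refine (Runs.pop_seq (Runs.push _ _ _ _)).conv le_rfl fun k => ?_
      have e : (s (.a m)).drop j = (s (.a m))[j] :: (s (.a m)).drop (j + 1) :=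
        List.drop_eq_getElem_cons hj'
      have e' : ((s (.a m)).take (j + 1)).reverse =
          (s (.a m))[j] :: ((s (.a m)).take j).reverse := by
        rw [← List.take_append_getElem hj']
        simp
      simp only [update_apply, e']
      split_ifs <;> simp_all
  · simp only [update_apply]
    split_ifs <;> simp_all
  · simp only [update_apply]
    split_ifs <;> simp_all

/-- Move the cells of `m` that precede the cell `(x, y)` to `t`. -/
def Prog.navigate (m : M) (x y : X) : Prog (Stk X M) :=
  .seq (.copy .t (.v x) .u) (.seq .rows (.seq (.copy .t (.v y) .p) (.walk m)))

theorem runs_navigate {n i j : ℕ} {m : M} {x y : X} {s : Stk X M → List Sym} (hs : Clean n s)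
    {l l' : List Sym} (hx : s (.v x) = List.replicate i tok ++ none :: l)
    (hy : s (.v y) = List.replicate j tok ++ none :: l') (hi : i < n) (hj : j < n)
    (hm : (s (.a m)).length = n * n) (r) :
    Runs (.navigate m x y) r s (8 * (n * n) + 17 * n + 8)
      (update (update s (.a m) ((s (.a m)).drop (i * n + j))) .t
        ((s (.a m)).take (i * n + j)).reverse) := by
  obtain ⟨hn, hp, hu, ht⟩ := hs
  have hin : i * n + n ≤ n * n := by
    rw [← Nat.succ_mul]
    exact Nat.mul_le_mul_right n hi
  refine (Runs.seq (runs_copy (by simp) (by simp) (by simp) hx ht r) fun r => Runs.seq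
    (runs_rows (n := n) (i := i) (by simp [hn]) (by simp [ht]) (by simp [hu]) r) fun r => Runs.seq
    (runs_copy (j := j) (l := l') (by simp) (by simp) (by simp) (by simp [hy]) (by simp [ht]) r)
    fun r => runs_walk (k := i * n + j) ?_ (by simp [ht]) ?_ r).conv ?_ fun k => ?_
  · simp [hp, Nat.add_comm (i * n) j]
  · simp only [update_apply]
    simp [hm]
    omega
  · have : i * (5 * n + 4) = 5 * (i * n) + 4 * i := by ring
    rw [this]
    omega
  · simp only [update_apply]
    split_ifs <;> simp_all

/-- Push the cell `(x, y)` of the matrix `m` to `e`. -/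
def Prog.read (m : M) (x y : X) : Prog (Stk X M) :=
  .seq (.navigate m x y) (.seq (.pop (.a m)) (.seq (.put (.a m)) (.seq (.put .e)
    (.move .t (.a m) Option.isSome))))

/-- Pop a bit from `e` and store it in the cell `(x, y)` of the matrix `m`. -/
def Prog.write (m : M) (x y : X) : Prog (Stk X M) :=
  .seq (.navigate m x y) (.seq (.pop (.a m)) (.seq (.pop .e) (.seq (.put (.a m))
    (.move .t (.a m) Option.isSome))))

theorem runs_read {n i j : ℕ} {m : M} {x y : X} {s : Stk X M → List Sym} (hs : Clean n s)
    {l l' : List Sym} (hx : s (.v x) = List.replicate i tok ++ none :: l)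
    (hy : s (.v y) = List.replicate j tok ++ none :: l') (hi : i < n) (hj : j < n)
    (hm : (s (.a m)).length = n * n) {b : Sym} (hb : (s (.a m))[i * n + j]? = some b) (r) :
    Runs (.read m x y) r s (10 * (n * n) + 17 * n + 12) (update s .e (b :: s .e)) := by
  have ht := hs.t
  have h := runs_navigate hs hx hy hi hj hm
  generalize i * n + j = k at *
  obtain ⟨hk, rfl⟩ := List.getElem?_eq_some_iff.1 hb
  have e : (s (.a m)).take k ++ (s (.a m))[k] :: (s (.a m)).drop (k + 1) = s (.a m) := by
    rw [← List.drop_eq_getElem_cons hk, List.take_append_drop]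
  have e' : (s (.a m))[k]?.getD none = (s (.a m))[k] := by simp [hk]
  refine (Runs.seq (h r) fun r => Runs.pop_seq (Runs.push_seq (Runs.push_seq
    (runs_move (l := ((s (.a m)).take k).reverse) (l' := []) (by simp) (by simp) (by simp)
      (by simp) _)))).conv ?_ fun k => ?_
  · simp
    omega
  · simp only [update_apply]
    split_ifs <;> simp_all

theorem runs_write {n i j : ℕ} {m : M} {x y : X} {s : Stk X M → List Sym} (hs : Clean n s)
    {l l' : List Sym} (hx : s (.v x) = List.replicate i tok ++ none :: l)
    (hy : s (.v y) = List.replicate j tok ++ none :: l') (hi : i < n) (hj : j < n)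
    (hm : (s (.a m)).length = n * n) {b : Sym} {l'' : List Sym} (he : s .e = b :: l'') (r) :
    Runs (.write m x y) r s (10 * (n * n) + 17 * n + 12)
      (update (update s .e l'') (.a m) ((s (.a m)).set (i * n + j) b)) := by
  have ht := hs.t
  have h := runs_navigate hs hx hy hi hj hm
  have hk : i * n + j < (s (.a m)).length := by
    rw [hm]
    nlinarith
  generalize i * n + j = k at *
  refine (Runs.seq (h r) fun r => Runs.pop_seq (Runs.pop_seq (Runs.push_seq
    (runs_move (l := ((s (.a m)).take k).reverse) (l' := []) (by simp) (by simp) (by simp)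
      (by simp) _)))).conv ?_ fun k => ?_
  · simp
    omega
  · simp only [update_apply]
    split_ifs <;> simp_all [List.set_eq_take_append_cons_drop]

end GraphDuplication

namespace GraphDuplication

open Function

/-! ### Matrices as lists of bits -/

section Cells

/-- The truth value of a proposition, as a symbol. -/
noncomputable def bit (P : Prop) : Sym := some (@decide P (Classical.propDecidable P))

theorem bit_congr {P Q : Prop} (h : P ↔ Q) : bit P = bit Q := by rw [propext h]

theorem bit_of_true {P : Prop} (h : P) : bit P = tok := by simp [bit, h]

theorem bit_of_false {P : Prop} (h : ¬P) : bit P = some false := by simp [bit, h]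

@[simp] theorem isTok_bit {P : Prop} : isTok (some (bit P)) = true ↔ P := by simp [bit]

@[simp] theorem isTok_bit_eq_false {P : Prop} : isTok (some (bit P)) = false ↔ ¬P := by simp [bit]

theorem not_isTok_bit {P : Prop} : some (!isTok (some (bit P))) = bit (¬P) := by
  by_cases h : P <;> simp [bit, h]

/-- The cells of a matrix, row by row. -/
noncomputable def cells {n : ℕ} (A : Fin n → Fin n → Prop) : List Sym :=
  List.ofFn fun k : Fin (n * n) => bit (A k.divNat k.modNat)

/-- The matrix `A` with the cell `(i, j)` set to `P`. -/
def setCell {n : ℕ} (A : Fin n → Fin n → Prop) (i j : Fin n) (P : Prop) (i' j' : Fin n) : Prop :=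
  (i' = i ∧ j' = j ∧ P) ∨ (¬(i' = i ∧ j' = j) ∧ A i' j')

/-- The number of cells of a matrix that hold. -/
noncomputable def size {n : ℕ} (A : Fin n → Fin n → Prop) : ℕ :=
  {p : Fin n × Fin n | A p.1 p.2}.ncard

@[simp] theorem length_cells {n : ℕ} (A : Fin n → Fin n → Prop) :
    (cells A).length = n * n := by
  simp [cells]

theorem exists_bit_of_mem_cells {n : ℕ} {A : Fin n → Fin n → Prop} {b : Sym} (h : b ∈ cells A) :
    ∃ c : Bool, b = some c := by
  simp only [cells, List.mem_ofFn] at h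
  obtain ⟨k, rfl⟩ := h
  exact ⟨_, rfl⟩

theorem index_lt {n : ℕ} (i j : Fin n) : (i : ℕ) * n + j < n * n := by
  have := Nat.mul_le_mul_right n (Nat.succ_le_of_lt i.2)
  have := j.2
  rw [Nat.succ_mul] at *
  omega

theorem divNat_index {n : ℕ} (i j : Fin n) :
    (⟨i * n + j, index_lt i j⟩ : Fin (n * n)).divNat = i := by
  ext
  have hn : 0 < n := by have := i.2; omega
  simp [Fin.divNat, Nat.mul_comm _ n, Nat.mul_add_div hn, Nat.div_eq_of_lt j.2]

theorem modNat_index {n : ℕ} (i j : Fin n) :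
    (⟨i * n + j, index_lt i j⟩ : Fin (n * n)).modNat = j := by
  ext
  simp [Fin.modNat, Nat.mul_comm _ n, Nat.mod_eq_of_lt j.2]

theorem index_divNat_modNat {n : ℕ} (k : Fin (n * n)) :
    (k.divNat : ℕ) * n + k.modNat = k := by
  simp only [Fin.divNat, Fin.modNat, Nat.mul_comm _ n]
  exact Nat.div_add_mod _ _

theorem cells_getElem? {n : ℕ} (A : Fin n → Fin n → Prop) (i j : Fin n) :
    (cells A)[(i : ℕ) * n + j]? = some (bit (A i j)) := by
  rw [List.getElem?_eq_getElem (by rw [length_cells]; exact index_lt i j)]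
  simp only [cells, List.getElem_ofFn, divNat_index, modNat_index]

theorem cells_set {n : ℕ} (A : Fin n → Fin n → Prop) (i j : Fin n) (P : Prop) :
    (cells A).set ((i : ℕ) * n + j) (bit P) = cells (setCell A i j P) := by
  apply List.ext_getElem (by simp)
  intro k h1 h2
  have hk : k < n * n := by simpa using h2
  rw [List.getElem_set]
  simp only [cells, List.getElem_ofFn, setCell]
  have : (i : ℕ) * n + j = k ↔
      (⟨k, hk⟩ : Fin (n * n)).divNat = i ∧ (⟨k, hk⟩ : Fin (n * n)).modNat = j := by
    constructor
    · rintro rfl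
      exact ⟨divNat_index i j, modNat_index i j⟩
    · rintro ⟨rfl, rfl⟩
      exact index_divNat_modNat ⟨k, hk⟩
  split_ifs with h
  · rw [this] at h
    exact bit_congr (by tauto)
  · rw [this] at h
    exact bit_congr (by tauto)

theorem count_cells {n : ℕ} (A : Fin n → Fin n → Prop) : (cells A).count tok = size A := by
  classical
  have h1 : (cells A).count tok =
      (Finset.univ.filter fun k : Fin (n * n) => A k.divNat k.modNat).card := by
    rw [← List.toFinset_finRange, List.Nodup.card_eq_countP (List.nodup_finRange _), cells,
      List.ofFn_eq_map, List.count, List.countP_map]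
    congr 1
    funext k
    simp [bit]
  rw [h1, size, Set.ncard_eq_toFinset_card']
  refine Finset.card_bij (fun k _ => (k.divNat, k.modNat)) (by simp) ?_ ?_
  · intro k _ k' _ h
    rw [Prod.mk.injEq] at h
    ext
    rw [← index_divNat_modNat k, h.1, h.2, index_divNat_modNat]
  · rintro ⟨i, j⟩ h
    exact ⟨⟨i * n + j, index_lt i j⟩, by simpa [divNat_index, modNat_index] using h,
      by simp [divNat_index, modNat_index]⟩

theorem exists_cells_eq {n : ℕ} {l : List Sym} (hl : l.length = n * n)
    (hb : ∀ b ∈ l, ∃ c : Bool, b = some c) : ∃ A : Fin n → Fin n → Prop, cells A = l := by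
  refine ⟨fun i j => l[(i : ℕ) * n + j]? = some tok, ?_⟩
  apply List.ext_getElem (by simp [hl])
  intro k h1 h2
  obtain ⟨c, hc⟩ := hb l[k] (List.getElem_mem h2)
  simp only [cells, List.getElem_ofFn]
  have : l[(⟨k, by omega⟩ : Fin (n * n)).divNat * n + (⟨k, by omega⟩ : Fin (n * n)).modNat]? =
      some tok ↔ c = true := by
    rw [index_divNat_modNat ⟨k, _⟩, List.getElem?_eq_getElem h2, hc]
    simp
  rw [hc, bit_congr this]
  cases c <;> simp [bit]

theorem cells_adj {n : ℕ} (G : Digraph (Fin n)) : cells G.Adj = (adjacencyBits G).map some := by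
  classical
  have : ∀ f : Fin (n * n) → Sym, List.ofFn f =
      (List.finRange n).flatMap fun i : Fin n => (List.finRange n).map fun j : Fin n =>
        f ⟨i * n + j, index_lt i j⟩ := by
    intro f
    rw [List.ofFn_mul, List.flatMap, ← List.ofFn_eq_map]
    simp only [← List.ofFn_eq_map]
  simp only [cells, this, adjacencyBits, divNat_index, modNat_index, List.map_flatMap,
    List.map_map]
  rfl

end Cells

/-! ### A language for matrices -/

/-- First-order formulas about the matrices in `M`, with variables in `X`; `le m m'` says that the
matrix `m` has at most as many cells that hold as `m'`. -/
inductive Fm (X M : Type) : Type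
  | rel (m : M) (x y : X) : Fm X M
  | not (φ : Fm X M) : Fm X M
  | and (φ ψ : Fm X M) : Fm X M
  | ex (x : X) (φ : Fm X M) : Fm X M
  | le (m m' : M) : Fm X M

/-- Commands: to set a cell to the truth value of a formula, composition, and bounded loops. -/
inductive Cmd (X M : Type) : Type
  | set (m : M) (x y : X) (φ : Fm X M) : Cmd X M
  | seq (c d : Cmd X M) : Cmd X M
  | loop (x : X) (c : Cmd X M) : Cmd X M

/-- Apply `f 0`, `f 1`, …, `f (i - 1)` in this order (and nothing for indices from `n` on). -/
def iterTo {n : ℕ} {S : Type*} (f : Fin n → S → S) (a : S) : ℕ → S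
  | 0 => a
  | i + 1 => if h : i < n then f ⟨i, h⟩ (iterTo f a i) else iterTo f a i

theorem iterTo_induction {n : ℕ} {S : Type*} {f : Fin n → S → S} {a : S} (P : ℕ → S → Prop)
    (h0 : P 0 a) (hs : ∀ (i : Fin n) b, P i b → P (i + 1) (f i b)) : P n (iterTo f a n) := by
  suffices ∀ i ≤ n, P i (iterTo f a i) from this n le_rfl
  intro i hi
  induction i with
  | zero => exact h0
  | succ i ih =>
    rw [iterTo, dif_pos (by omega)]
    exact hs ⟨i, by omega⟩ _ (ih (by omega))

variable {X M : Type} [DecidableEq X] [DecidableEq M]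

/-- The truth of a formula, for matrices `A` and values `v` of the variables. -/
def Fm.Holds {n : ℕ} (A : M → Fin n → Fin n → Prop) : Fm X M → (X → Fin n) → Prop
  | .rel m x y, v => A m (v x) (v y)
  | .not φ, v => ¬φ.Holds A v
  | .and φ ψ, v => φ.Holds A v ∧ ψ.Holds A v
  | .ex x φ, v => ∃ i, φ.Holds A (update v x i)
  | .le m m', _ => size (A m) ≤ size (A m')

/-- The matrices after the execution of a command. A loop binds its variable. -/
def Cmd.eval {n : ℕ} : Cmd X M → (X → Fin n) → (M → Fin n → Fin n → Prop) →
    (M → Fin n → Fin n → Prop)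
  | .set m x y φ, v, A => update A m (setCell (A m) (v x) (v y) (φ.Holds A v))
  | .seq c d, v, A => d.eval v (c.eval v A)
  | .loop x c, v, A => iterTo (fun i => c.eval (update v x i)) A n

/-! ### Programs for formulas and commands -/

/-- The loop in which the variable `x` runs through `0, …, n - 1`. -/
def Prog.forLoop (x : X) (p : Prog (Stk X M)) : Prog (Stk X M) :=
  .seq (.push (.v x) fun _ => none) (.seq (.push (.w x) fun _ => none) (.seq (.copy .t .n (.w x))
    (.seq (.loop (.w x) isTok (.seq p (.push (.v x) fun _ => tok))) (.drain (.v x) isTok))))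

/-- Use the stack `p` to process the bits `true` of the matrix `m`. -/
def Prog.sweep (m : M) (p : Prog (Stk X M)) : Prog (Stk X M) :=
  .seq (.loop (.a m) isBit (.seq (.put .t) (.ite isTok p .skip))) (.move .t (.a m) isBit)

/-- The program that evaluates a formula and pushes its truth value to `e`. -/
def Fm.prog : Fm X M → Prog (Stk X M)
  | .rel m x y => .read m x y
  | .not φ => .seq φ.prog (.seq (.pop .e) (.push .e fun r => some !(isTok r)))
  | .and φ ψ => .seq φ.prog (.seq ψ.prog (.seq (.pop .e)
      (.ite isTok .skip (.seq (.pop .e) (.push .e fun _ => some false)))))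
  | .ex x φ => .seq (.push .e fun _ => some false) (.forLoop x (.seq φ.prog (.seq (.pop .e)
      (.ite isTok (.seq (.pop .e) (.push .e fun _ => tok)) .skip))))
  -- A `pop` from an empty stack has no effect, so `p` is empty afterwards iff `m ≤ m'`.
  | .le m m' => .seq (.sweep m (.push .p fun _ => tok)) (.seq (.sweep m' (.pop .p))
      (.seq (.pop .p) (.seq (.push .e fun r => some !(isTok r)) (.drain .p isTok))))

/-- The program that executes a command. -/
def Cmd.prog : Cmd X M → Prog (Stk X M)
  | .set m x y φ => .seq φ.prog (.write m x y)
  | .seq c d => .seq c.prog d.prog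
  | .loop x c => .forLoop x c.prog

/-- The stacks hold the values `v` of the variables and the matrices `A`. -/
structure Rep {n : ℕ} (v : X → Fin n) (A : M → Fin n → Fin n → Prop) (s : Stk X M → List Sym) :
    Prop extends Clean n s where
  var : ∀ x, ∃ l, s (.v x) = List.replicate (v x) tok ++ none :: l
  mat : ∀ m, s (.a m) = cells (A m)

/-- The stacks inside of a loop over `x`, in the iteration for the value `i` and with `j` more
iterations to come. -/
def inLoop (s : Stk X M → List Sym) (x : X) (i j : ℕ) : Stk X M → List Sym :=
  update (update s (.v x) (List.replicate i tok ++ none :: s (.v x))) (.w x)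
    (List.replicate j tok ++ none :: s (.w x))

/-- The stacks with other matrices. -/
noncomputable def withMats {n : ℕ} (s : Stk X M → List Sym) (A : M → Fin n → Fin n → Prop) :
    Stk X M → List Sym
  | .a m => cells (A m)
  | k => s k

omit [DecidableEq X] [DecidableEq M] in
theorem Rep.withMats {n : ℕ} {v : X → Fin n} {A A' : M → Fin n → Fin n → Prop} {s}
    (h : Rep v A s) : Rep v A' (withMats s A') :=
  ⟨⟨h.n, h.p, h.u, h.t⟩, h.var, fun _ => rfl⟩

omit [DecidableEq X] [DecidableEq M] in
theorem Rep.withMats_self {n : ℕ} {v : X → Fin n} {A : M → Fin n → Fin n → Prop} {s}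
    (h : Rep v A s) : GraphDuplication.withMats s A = s := by
  funext k
  cases k <;> simp [GraphDuplication.withMats, h.mat]

theorem Rep.update_e {n : ℕ} {v : X → Fin n} {A : M → Fin n → Fin n → Prop} {s}
    (h : Rep v A s) (l : List Sym) : Rep v A (update s .e l) :=
  ⟨⟨by simp [h.n], by simp [h.p], by simp [h.u], by simp [h.t]⟩,
    fun x => by simpa using h.var x, fun m => by simp [h.mat]⟩

theorem Rep.inLoop {n : ℕ} {v : X → Fin n} {A : M → Fin n → Fin n → Prop} {s}
    (h : Rep v A s) (x : X) (i : Fin n) (j : ℕ) : Rep (update v x i) A (inLoop s x i j) := by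
  refine ⟨⟨by simp [GraphDuplication.inLoop, h.n], by simp [GraphDuplication.inLoop, h.p],
    by simp [GraphDuplication.inLoop, h.u], by simp [GraphDuplication.inLoop, h.t]⟩,
    fun y => ?_, fun m => by simp [GraphDuplication.inLoop, h.mat]⟩
  by_cases hy : y = x
  · subst hy
    exact ⟨s (.v y), by simp [GraphDuplication.inLoop]⟩
  · simpa [GraphDuplication.inLoop, hy] using h.var y

theorem runs_forLoop {n : ℕ} {x : X} {p : Prog (Stk X M)} {T : ℕ} (S : ℕ → Stk X M → List Sym)
    (hs : Clean n (S 0)) (hv : ∀ i, S i (.v x) = S 0 (.v x)) (hw : ∀ i, S i (.w x) = S 0 (.w x))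
    (hp : ∀ i < n, ∀ r, Runs p r (inLoop (S i) x i (n - (i + 1))) T
      (inLoop (S (i + 1)) x i (n - (i + 1)))) (r) :
    Runs (.forLoop x p) r (S 0) (n * (T + 9) + 7) (S n) := by
  have h1 : ∀ r, Runs (.loop (.w x) isTok (.seq p (.push (.v x) fun _ => tok))) r
      (inLoop (S 0) x 0 n) (n * (T + 1 + 1) + 1)
      (update (S n) (.v x) (List.replicate n tok ++ none :: S 0 (.v x))) := by
    refine Runs.loop_conv (T + 1) n (fun i => inLoop (S i) x i (n - i)) (fun i hi => ?_)
      (by simp [inLoop]) le_rfl (fun k => ?_) fun k => ?_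
    · refine ⟨tok, List.replicate (n - (i + 1)) tok ++ none :: S 0 (.w x), ?_, rfl, ?_⟩
      · obtain ⟨d, hd⟩ : ∃ d, n - i = d + 1 := ⟨n - (i + 1), by omega⟩
        have : n - (i + 1) = d := by omega
        simp [inLoop, hw i, hd, this, List.replicate_succ]
      · refine (Runs.seq (s' := inLoop (S (i + 1)) x i (n - (i + 1))) (T := T) ?_
          fun r => Runs.push _ _ _ _).conv le_rfl fun k => ?_
        · convert hp i hi (some tok) using 1
          simp [inLoop, hw i]
        · simp only [inLoop, update_apply]
          split_ifs <;> simp_all [List.replicate_succ]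
    · simp [inLoop]
    · have := hv n
      have := hw n
      simp only [inLoop, update_apply]
      split_ifs <;> simp_all
  refine (Runs.push_seq (Runs.push_seq (Runs.seq
    (runs_copy (j := n) (l := []) (by simp) (by simp) (by simp) (by simp [hs.n]) (by simp [hs.t]) _)
    fun r => Runs.seq (s' := update (S n) (.v x) (List.replicate n tok ++ none :: S 0 (.v x)))
      (T := n * (T + 1 + 1) + 1) ?_
      fun r => runs_drain (l := List.replicate n tok) (l' := none :: S 0 (.v x))
        (by simp) (by simp +contextual) rfl r))).conv ?_ fun k => ?_
  · convert h1 r using 1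
    funext k
    simp only [inLoop, update_apply]
    split_ifs <;> simp_all
  · simp
    ring_nf
    omega
  · have := hv n
    simp only [update_apply]
    split_ifs <;> simp_all

theorem runs_sweep {m : M} {p : Prog (Stk X M)} (f : List Sym → List Sym)
    (hp : ∀ r s, Runs p r s 1 (update s .p (f (s .p)))) {s : Stk X M → List Sym}
    (ht : s .t = []) (hm : ∀ b ∈ s (.a m), ∃ c : Bool, b = some c) (r) :
    Runs (.sweep m p) r s (6 * (s (.a m)).length + 2)
      (update s .p (f^[(s (.a m)).count tok] (s .p))) := by
  set l := s (.a m) with hl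
  have h1 : ∀ r, Runs (.loop (.a m) isBit (.seq (.put .t) (.ite isTok p .skip))) r s
      (l.length * (3 + 1) + 1)
      (update (update (update s (.a m) []) .t l.reverse) .p (f^[l.count tok] (s .p))) := by
    refine Runs.loop_conv 3 l.length (fun i => update (update (update s (.a m) (l.drop i)) .t
      (l.take i).reverse) .p (f^[(l.take i).count tok] (s .p))) (fun i hi => ?_)
      (by simp) le_rfl (fun k => ?_) fun k => ?_
    · obtain ⟨c, hc⟩ := hm _ (List.getElem_mem hi)
      have e : (l.take (i + 1)) = l.take i ++ [some c] := by
        rw [← hc, ← List.take_append_getElem hi]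
      refine ⟨some c, l.drop (i + 1), ?_, rfl, ?_⟩
      · simp [← hc]
      · refine (Runs.push_seq (Runs.ite
          (s' := update (update (update s (.a m) (l.drop (i + 1))) .t (l.take (i + 1)).reverse) .p
            (f^[(l.take (i + 1)).count tok] (s .p)))
          (fun h => (hp _ _).conv le_rfl fun k => ?_)
          fun h => (Runs.skip _ _).conv le_rfl fun k => ?_)).mono le_rfl
        · rw [isTok_some] at h
          subst h
          simp only [update_apply, e, List.count_append, List.count_singleton_self,
            iterate_succ_apply']
          split_ifs <;> simp_all
        · rw [isTok_some] at h
          subst h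
          have e0 : List.count tok [some false] = 0 := rfl
          simp only [update_apply, e, List.count_append, e0, add_zero]
          split_ifs <;> simp_all
    · simp only [update_apply]
      split_ifs <;> simp_all
    · simp only [update_apply]
      split_ifs <;> simp_all
  refine (Runs.seq (h1 r) fun r => runs_move (l := l.reverse) (l' := []) (by simp) (by simp)
    (fun b hb => ?_) rfl r).conv ?_ fun k => ?_
  · obtain ⟨c, rfl⟩ := hm b (List.mem_reverse.1 hb)
    rfl
  · simp
    omega
  · simp only [update_apply]
    split_ifs <;> simp_all

theorem iterate_cons_tok (i : ℕ) (l : List Sym) :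
    (fun l => tok :: l)^[i] l = List.replicate i tok ++ l := by
  induction i with
  | zero => rfl
  | succ i ih => rw [iterate_succ_apply', ih, List.replicate_succ, List.cons_append]

/-- Formulas are evaluated in polynomial time. -/
theorem Fm.runs (φ : Fm X M) : ∃ P : Polynomial ℕ, ∀ (n : ℕ) (v : X → Fin n)
    (A : M → Fin n → Fin n → Prop) (s : Stk X M → List Sym) (r : Option Sym), Rep v A s →
      Runs φ.prog r s (P.eval n) (update s .e (bit (φ.Holds A v) :: s .e)) := by
  induction φ with
  | rel m x y =>
    refine ⟨10 * (.X * .X) + 17 * .X + 12, fun n v A s r h => ?_⟩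
    obtain ⟨l, hx⟩ := h.var x
    obtain ⟨l', hy⟩ := h.var y
    refine (runs_read h.toClean hx hy (v x).2 (v y).2 (by simp [h.mat])
      (by rw [h.mat]; exact cells_getElem? _ _ _) r).conv (by simp) fun k => rfl
  | not φ ih =>
    obtain ⟨P, hP⟩ := ih
    refine ⟨P + 2, fun n v A s r h => ?_⟩
    refine (Runs.seq (hP n v A s r h) fun r => Runs.pop_seq (Runs.push _ _ _ _)).conv
      (by simp) fun k => ?_
    simp only [update_self, List.head?_cons, List.tail_cons, update_idem, not_isTok_bit]
    rfl
  | and φ ψ ih ih' =>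
    obtain ⟨P, hP⟩ := ih
    obtain ⟨P', hP'⟩ := ih'
    refine ⟨P + P' + 4, fun n v A s r h => ?_⟩
    refine (Runs.seq (hP n v A s r h) fun r => Runs.seq (hP' n v A _ r (h.update_e _)) fun r =>
      Runs.pop_seq (Runs.ite (T := 2)
        (s' := update s .e (bit ((φ.and ψ).Holds A v) :: s .e))
        (fun hc => (Runs.skip _ _).conv (by simp) fun k => ?_)
        fun hc => (Runs.pop_seq (Runs.push _ _ _ _)).conv (by simp) fun k => ?_)).conv
      (by simp; omega) fun k => rfl
    · simp only [update_self, List.head?_cons, isTok_bit] at hc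
      simp [bit_congr (show (φ.and ψ).Holds A v ↔ φ.Holds A v by simp [Fm.Holds, hc])]
    · simp only [update_self, List.head?_cons, isTok_bit_eq_false] at hc
      simp [bit_of_false (show ¬(φ.and ψ).Holds A v by simp [Fm.Holds, hc])]
  | ex x φ ih =>
    obtain ⟨P, hP⟩ := ih
    refine ⟨.X * (P + 4 + 9) + 8, fun n v A s r h => ?_⟩
    have h1 := runs_forLoop (x := x) (n := n) (T := P.eval n + 4)
      (p := .seq φ.prog (.seq (.pop .e)
        (.ite isTok (.seq (.pop .e) (.push .e fun _ => tok)) .skip)))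
      (fun i => update s .e
        (bit (∃ j : Fin n, j < i ∧ φ.Holds A (update v x j)) :: s .e))
      ((h.update_e _).toClean) (by simp) (by simp) fun i hi r => ?_
    · refine (Runs.push_seq (Runs.conv (T' := n * (P.eval n + 4 + 9) + 7) ?_ le_rfl
        fun k => rfl)).mono (by simp; omega)
      convert h1 r using 1
      · rw [bit_of_false (by simp)]
      · rw [bit_congr (show (Fm.ex x φ).Holds A v ↔
          ∃ j : Fin n, (j : ℕ) < n ∧ φ.Holds A (update v x j) by simp [Fm.Holds])]
    · have e : (∃ j : Fin n, (j : ℕ) < i + 1 ∧ φ.Holds A (update v x j)) ↔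
          (∃ j : Fin n, (j : ℕ) < i ∧ φ.Holds A (update v x j)) ∨
            φ.Holds A (update v x ⟨i, hi⟩) := by
        constructor
        · rintro ⟨j, hj, hφ⟩
          rcases Nat.lt_succ_iff_lt_or_eq.1 hj with hj | hj
          · exact Or.inl ⟨j, hj, hφ⟩
          · obtain rfl : j = ⟨i, hi⟩ := Fin.ext hj
            exact Or.inr hφ
        · rintro (⟨j, hj, hφ⟩ | hφ)
          · exact ⟨j, by omega, hφ⟩
          · exact ⟨⟨i, hi⟩, by simp, hφ⟩
      have h2 := hP n _ A _ r ((h.update_e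
        (bit (∃ j : Fin n, (j : ℕ) < i ∧ φ.Holds A (update v x j)) :: s .e)).inLoop x
        ⟨i, hi⟩ (n - (i + 1)))
      refine (Runs.seq h2 fun r => Runs.pop_seq (Runs.ite (T := 2)
        (s' := inLoop (update s .e (bit (∃ j : Fin n, (j : ℕ) < i + 1 ∧
          φ.Holds A (update v x j)) :: s .e)) x i (n - (i + 1)))
        (fun hc => (Runs.pop_seq (Runs.push _ _ _ _)).conv (by simp) fun k => ?_)
        fun hc => (Runs.skip _ _).conv (by simp) fun k => ?_)).mono (by omega)
      · simp only [update_self, List.head?_cons, isTok_bit] at hc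
        rw [bit_of_true (e.2 (Or.inr hc))]
        simp only [inLoop, update_apply]
        split_ifs <;> simp_all
      · simp only [update_self, List.head?_cons, isTok_bit_eq_false] at hc
        rw [bit_congr (e.trans (or_iff_left hc))]
        simp only [inLoop, update_apply]
        split_ifs <;> simp_all
  | le m m' =>
    refine ⟨14 * (.X * .X) + 7, fun n v A s r h => ?_⟩
    have hm : ∀ m, ∀ b ∈ s (.a m), ∃ c : Bool, b = some c := fun m b hb => by
      rw [h.mat] at hb
      exact exists_bit_of_mem_cells hb
    have c1 : ∀ m, (s (.a m)).length = n * n := fun m => by rw [h.mat, length_cells]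
    have c2 : ∀ m, (s (.a m)).count tok = size (A m) := fun m => by rw [h.mat, count_cells]
    have hle : size (A m) ≤ n * n := by
      rw [← c2 m, ← c1 m]
      exact List.count_le_length
    have htail : ∀ (i : ℕ) (l : List Sym), List.tail^[i] l = l.drop i := fun i => by
      induction i with
      | zero => simp
      | succ i ih => intro l; rw [iterate_succ_apply', ih, List.tail_drop]
    refine (Runs.seq (runs_sweep (fun l => tok :: l) (fun r s => Runs.push _ _ _ _) h.t (hm m) r)
      fun r => Runs.seq (runs_sweep List.tail (fun r s => Runs.pop _ _ _)
        (by simp [h.t]) (by simpa using hm m') r) fun r => Runs.pop_seq (Runs.push_seq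
          (runs_drain (l := List.replicate (size (A m) - size (A m') - 1) tok) (l' := []) ?_
            (by simp +contextual) rfl _))).conv ?_ fun k => ?_
    · simp [iterate_cons_tok, htail, c2, h.p]
    · simp [c1]
      omega
    · have hd : isTok (List.replicate (size (A m) - size (A m')) tok).head? =
          !isTok (some (bit (size (A m) ≤ size (A m')))) := by
        by_cases hs : size (A m) ≤ size (A m')
        · rw [Nat.sub_eq_zero_of_le hs]
          simp [bit, hs]
        · obtain ⟨d, hd⟩ : ∃ d, size (A m) - size (A m') = d + 1 :=
            ⟨size (A m) - size (A m') - 1, by omega⟩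
          rw [hd]
          simp [bit, hs, List.replicate_succ]
      have hd' : some (!isTok (List.replicate (size (A m) - size (A m')) tok).head?) =
          bit (size (A m) ≤ size (A m')) := by
        rw [hd, Bool.not_not]
        by_cases hs : size (A m) ≤ size (A m') <;> simp [bit, hs]
      have hp := h.p
      simp only [update_apply, Fm.Holds]
      split_ifs <;> simp_all [iterate_cons_tok]

/-- Commands are executed in polynomial time. -/
theorem Cmd.runs (c : Cmd X M) : ∃ P : Polynomial ℕ, ∀ (n : ℕ) (v : X → Fin n)
    (A : M → Fin n → Fin n → Prop) (s : Stk X M → List Sym) (r : Option Sym), Rep v A s →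
      Runs c.prog r s (P.eval n) (withMats s (c.eval v A)) := by
  induction c with
  | set m x y φ =>
    obtain ⟨P, hP⟩ := φ.runs
    refine ⟨P + (10 * (.X * .X) + 17 * .X + 12), fun n v A s r h => ?_⟩
    obtain ⟨l, hx⟩ := h.var x
    obtain ⟨l', hy⟩ := h.var y
    refine (Runs.seq (hP n v A s r h) fun r => runs_write (h.update_e _).toClean (m := m)
      (by simpa using hx) (by simpa using hy) (v x).2 (v y).2 (by simp [h.mat])
      (update_self _ _ _) r).conv (by simp) fun k => ?_
    have hm := h.mat
    rcases k with _ | _ | m' | _ | _ | _ | _ | _ | _ | _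
    case a =>
      by_cases hm' : m' = m
      · subst hm'
        simp [withMats, Cmd.eval, hm, cells_set]
      · simp [withMats, Cmd.eval, hm, hm']
    all_goals simp [withMats]
  | seq c d ih ih' =>
    obtain ⟨P, hP⟩ := ih
    obtain ⟨P', hP'⟩ := ih'
    refine ⟨P + P', fun n v A s r h => ?_⟩
    refine (Runs.seq (hP n v A s r h) fun r => hP' n v _ _ r h.withMats).conv (by simp) fun k => ?_
    cases k <;> rfl
  | loop x c ih =>
    obtain ⟨P, hP⟩ := ih
    refine ⟨.X * (P + 9) + 7, fun n v A s r h => ?_⟩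
    have h1 := runs_forLoop (x := x) (n := n) (T := P.eval n) (p := c.prog)
      (fun i => withMats s (iterTo (fun i => c.eval (update v x i)) A i))
      (h.withMats (A' := A)).toClean (by simp [withMats]) (by simp [withMats]) fun i hi r => ?_
    · refine Runs.conv ?_ (T := n * (P.eval n + 9) + 7) (by simp) fun k => rfl
      have h2 := h1 r
      rwa [iterTo, h.withMats_self] at h2
    · refine (hP n _ _ _ r ((h.withMats (A' := iterTo (fun i => c.eval (update v x i)) A i)).inLoop
        x ⟨i, hi⟩ (n - (i + 1)))).conv le_rfl fun k => ?_
      rw [iterTo, dif_pos hi]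
      cases k <;> simp [withMats, inLoop, update_apply]

end GraphDuplication

namespace GraphDuplication

open Function

/-! ### Reading the input -/

section ForEach

variable {K ι : Type} [DecidableEq K]

/-- Run the programs `f i`, for all `i` in a list. -/
def Prog.forEach (f : ι → Prog K) : List ι → Prog K
  | [] => .skip
  | i :: l => .seq (f i) (Prog.forEach f l)

/-- If `f i` changes the stack `key i` only, then running all of the `f i` achieves on every stack
`key i` what `f i` does; `J` is an invariant. -/
theorem runs_forEach {f : ι → Prog K} {key : ι → K} (hkey : Injective key)
    {J : (K → List Sym) → Prop} {Q : ι → List Sym → Prop} {T : ℕ} {l : List ι} (hl : l.Nodup)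
    {s : K → List Sym} (hs : J s)
    (hf : ∀ i ∈ l, ∀ s₁, J s₁ → s₁ (key i) = s (key i) → ∃ s₂, J s₂ ∧ Q i (s₂ (key i)) ∧
      (∀ k ≠ key i, s₂ k = s₁ k) ∧ ∀ r, Runs (f i) r s₁ T s₂) :
    ∃ s', J s' ∧ (∀ i ∈ l, Q i (s' (key i))) ∧ (∀ k, (∀ i ∈ l, k ≠ key i) → s' k = s k) ∧
      ∀ r, Runs (.forEach f l) r s (l.length * T + 1) s' := by
  induction l generalizing s with
  | nil => exact ⟨s, hs, by simp, by simp, fun r => (Runs.skip r s).mono (by simp)⟩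
  | cons i l ih =>
    rw [List.nodup_cons] at hl
    obtain ⟨s₁, hJ₁, hQ₁, hk₁, hr₁⟩ := hf i (by simp) s hs rfl
    obtain ⟨s₂, hJ₂, hQ₂, hk₂, hr₂⟩ := ih hl.2 (s := s₁) hJ₁ fun j hj s₂ hJ₂ hs₂ =>
      hf j (by simp [hj]) s₂ hJ₂ (by
        rw [hs₂, hk₁]
        intro h
        exact hl.1 (hkey h ▸ hj))
    refine ⟨s₂, hJ₂, fun j hj => ?_, fun k hk => ?_, fun r => ?_⟩
    · rcases List.mem_cons.1 hj with rfl | hj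
      · rw [hk₂]
        · exact hQ₁
        · intro j' hj' h
          exact hl.1 (hkey h ▸ hj')
      · exact hQ₂ j hj
    · rw [hk₂ k fun j hj => hk j (by simp [hj]), hk₁ k (hk i (by simp))]
    · refine ((hr₁ r).seq hr₂).mono ?_
      rw [List.length_cons, Nat.succ_mul]
      omega

end ForEach

/-- The number with the binary digits `l`, the least significant one first. -/
def value (l : List Bool) : ℕ := l.foldr (fun b v => b.toNat + 2 * v) 0

theorem value_encodePosNum (p : PosNum) : value (Computability.encodePosNum p) = p := by
  induction p with
  | one => rfl
  | bit1 p ih =>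
    rw [PosNum.cast_bit1, ← ih]
    simp [value, Computability.encodePosNum]
    ring
  | bit0 p ih =>
    rw [PosNum.cast_bit0, ← ih]
    simp [value, Computability.encodePosNum]
    ring

theorem value_encodeNat (n : ℕ) : value (Computability.encodeNat n) = n := by
  rw [Computability.encodeNat]
  conv_rhs => rw [← Num.to_of_nat n]
  cases (n : Num) with
  | zero => rfl
  | pos p => exact value_encodePosNum p

theorem value_replicate_false (j : ℕ) (l : List Bool) :
    value (List.replicate j false ++ l) = 2 ^ j * value l := by
  induction j with
  | zero => simp
  | succ j ih =>
    simp only [value, List.replicate_succ, List.cons_append, List.foldr_cons] at ih ⊢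
    rw [ih, pow_succ]
    simp
    ring

theorem value_replicate_true (j : ℕ) (l : List Bool) :
    value (List.replicate j true ++ l) + 1 = 2 ^ j * (value l + 1) := by
  induction j with
  | zero => simp
  | succ j ih =>
    simp only [value, List.replicate_succ, List.cons_append, List.foldr_cons] at ih ⊢
    rw [pow_succ, mul_right_comm, ← ih]
    simp
    ring

theorem eq_replicate_or (l : List Bool) : (∃ j, l = List.replicate j false) ∨
    ∃ j l', l = List.replicate j false ++ true :: l' := by
  induction l with
  | nil => exact Or.inl ⟨0, rfl⟩
  | cons b l ih =>
    cases b with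
    | true => exact Or.inr ⟨0, l, rfl⟩
    | false =>
      rcases ih with ⟨j, rfl⟩ | ⟨j, l', rfl⟩
      · exact Or.inl ⟨j + 1, rfl⟩
      · exact Or.inr ⟨j + 1, l', rfl⟩

variable {X M : Type} [DecidableEq X] [DecidableEq M]

/-- Move a binary number from the stack `a m` to `z`. -/
def Prog.readNumber (m : M) : Prog (Stk X M) :=
  .seq (.move (.a m) .e isBit) (.move .e .z isBit)

theorem runs_readNumber {m : M} {s : Stk X M → List Sym} {l : List Bool} {l' : List Sym}
    (hm : s (.a m) = l.map some ++ none :: l') (he : s .e = []) (hz : s .z = []) (r) :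
    Runs (.readNumber m) r s (4 * l.length + 2)
      (update (update s (.a m) l') .z (l.map some)) := by
  refine (Runs.seq (runs_move (by simp) hm (by
    simp only [List.mem_map, forall_exists_index, and_imp]
    rintro _ b _ rfl
    rfl) rfl r) fun r => runs_move
    (l := (l.map some).reverse) (l' := []) (by simp) (by simp [he]) (by
      simp only [List.mem_reverse, List.mem_map, forall_exists_index, and_imp]
      rintro _ b _ rfl
      rfl) rfl r).conv ?_
    fun k => ?_
  · simp
    omega
  · simp only [update_apply]
    split_ifs <;> simp_all

/-- The test for the bit `false`. -/
def isFalse (r : Option Sym) : Bool := decide (r = some (some false))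

/-- Subtract one from the binary number on `z` and run `f`; or run `g`, if the number was zero.
The digits `0` below the lowest digit `1` are moved to `t`; that digit becomes `0` and they come
back as digits `1`. If there is no digit `1`, the number is zero, and its digits are dropped. -/
def Prog.decrement (f g : Prog (Stk X M)) : Prog (Stk X M) :=
  .seq (.move .z .t isFalse) (.ite isTok
    (.seq (.push .z fun _ => some false) (.seq (.loop .t isBit (.push .z fun _ => tok)) f))
    (.seq (.drain .t isBit) g))

theorem runs_decrement_zero {f g : Prog (Stk X M)} {s s' : Stk X M → List Sym} {l : List Bool}
    {T : ℕ} (hz : s .z = l.map some) (ht : s .t = []) (hl : value l = 0)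
    (h : ∀ r, Runs g r (update s .z []) T s') (r) :
    Runs (.decrement f g) r s (4 * l.length + T + 3) s' := by
  rcases eq_replicate_or l with ⟨j, rfl⟩ | ⟨j, l', rfl⟩
  · refine (Runs.exec_seq (exec_move (l := List.replicate j (some false)) (l' := []) (by simp)
      (by simp [hz]) (by simp [isFalse]) rfl r) (Runs.ite (T := 2 * j + 1 + T) (by simp) fun _ =>
        Runs.seq (runs_drain (l := List.replicate j (some false)) (l' := []) (by simp [ht])
          (by simp) rfl _ |>.mono (by simp)) fun r => ?_)).mono (by simp; omega)
    convert h r using 1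
    funext k
    simp only [update_apply]
    split_ifs <;> simp_all
  · rw [value_replicate_false] at hl
    simp [value] at hl

/-- The decrement keeps the number of digits, so that its running time does not change in a loop. -/
theorem runs_decrement_succ {l : List Bool} (hl : value l ≠ 0) : ∃ l' : List Bool,
    l'.length = l.length ∧ value l = value l' + 1 ∧
    ∀ {f g : Prog (Stk X M)} {s s' : Stk X M → List Sym} {T : ℕ}, s .z = l.map some → s .t = [] →
      (∀ r, Runs f r (update s .z (l'.map some)) T s') →
      ∀ r, Runs (.decrement f g) r s (4 * l.length + T + 4) s' := by
  rcases eq_replicate_or l with ⟨j, rfl⟩ | ⟨j, l', rfl⟩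
  · have hv : value (List.replicate j false) = 0 := by
      simpa [value] using value_replicate_false j []
    exact absurd hv hl
  · refine ⟨List.replicate j true ++ false :: l', by simp, ?_, fun {f g s s' T} hz ht h r => ?_⟩
    · have e1 := value_replicate_false j (true :: l')
      have e2 := value_replicate_true j (false :: l')
      have e3 : value (true :: l') = value (false :: l') + 1 := by simp [value, Nat.add_comm]
      rw [e1, e2, e3]
    have h2 : ∀ r, Runs (.loop .t isBit (.push .z fun _ => tok)) r
        (update (update s .t (List.replicate j (some false))) .z (some false :: l'.map some))
        (2 * j + 1) (update s .z ((List.replicate j true ++ false :: l').map some)) := by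
      refine Runs.loop_conv 1 j (fun i => update (update s .t (List.replicate (j - i) (some false)))
        .z (List.replicate i tok ++ some false :: l'.map some)) (fun i hi => ?_) (by simp)
        (by omega) (fun k => ?_) fun k => ?_
      · refine ⟨some false, List.replicate (j - (i + 1)) (some false), ?_, rfl, ?_⟩
        · simp only [update_apply]
          rw [← List.replicate_succ]
          simp
          omega
        · refine (Runs.push _ _ _ _).conv le_rfl fun k => ?_
          simp only [update_apply]
          split_ifs <;> simp_all [List.replicate_succ]
      · simp only [update_apply]
        split_ifs <;> simp_all
      · simp only [update_apply]
        split_ifs <;> simp_all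
    refine (Runs.exec_seq (exec_move (l := List.replicate j (some false))
      (l' := tok :: l'.map some) (by simp)
      (by simp [hz]) (by simp [isFalse]) rfl r) (Runs.ite (T := 1 + (2 * j + 1 + T)) (fun _ =>
        Runs.push_seq (Runs.seq
          (s' := update s .z ((List.replicate j true ++ false :: l').map some))
          ?_ h)) (by simp))).mono (by simp; omega)
    convert h2 _ using 1
    funext k
    simp only [update_apply]
    split_ifs <;> simp_all

/-- Turn the binary number on `z` into a block of symbols on `n`. The loop goes on as long as there
is a symbol on `r`, which the body pushes again unless the number is zero. -/
def Prog.unary : Prog (Stk X M) :=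
  .seq (.push .n fun _ => none) (.seq (.push .r fun _ => tok) (.loop .r isTok
    (.decrement (.seq (.push .n fun _ => tok) (.push .r fun _ => tok)) .skip)))

theorem runs_unary {s : Stk X M → List Sym} {l : List Bool} (hz : s .z = l.map some)
    (ht : s .t = []) (hr : s .r = []) (hn : s .n = []) (r) :
    Runs .unary r s ((value l + 1) * (4 * l.length + 7) + 3)
      (update (update s .z []) .n (List.replicate (value l) tok ++ [none])) := by
  have key : ∀ (i : ℕ) (l : List Bool) (s : Stk X M → List Sym), value l = i →
      s .z = l.map some → s .t = [] → s .r = [tok] → ∀ r,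
      Runs (.loop .r isTok
        (.decrement (.seq (.push .n fun _ => tok) (.push .r fun _ => tok)) .skip)) r s
        ((i + 1) * (4 * l.length + 7) + 1)
        (update (update (update s .z []) .r []) .n (List.replicate i tok ++ s .n)) := by
    intro i
    induction i with
    | zero =>
      intro l s hl hz ht hr r
      refine (Runs.loop_step r (s := s) (k := .r) (T := 4 * l.length + 1 + 3)
        (s' := update (update s .z []) .r []) (by rw [hr]; rfl)
        (runs_decrement_zero (l := l) (by simp [hz]) (by simp [ht]) hl (fun r =>
          (Runs.skip _ _).conv le_rfl fun k => ?_) _)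
        fun r => Runs.loop_done r (by simp)).conv (by omega) fun k => ?_
      · simp only [update_apply]
        split_ifs <;> simp_all
      · simp only [update_apply]
        split_ifs <;> simp_all
    | succ i ih =>
      intro l s hl hz ht hr r
      obtain ⟨l', hl', hv, hd⟩ := runs_decrement_succ (X := X) (M := M) (l := l) (by omega)
      have h1 := ih l' (update (update s .z (l'.map some)) .n (tok :: s .n)) (by omega) (by simp)
        (by simp [ht]) (by simp [hr])
      refine (Runs.loop_step r (s := s) (k := .r) (T := 4 * l.length + 2 + 4) (by rw [hr]; rfl)
        (hd (by simp [hz]) (by simp [ht]) (fun r =>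
          (Runs.push_seq (Runs.push _ _ _ _)).conv le_rfl fun k => ?_) _) h1).conv ?_ fun k => ?_
      · simp only [update_apply]
        split_ifs <;> simp_all
      · rw [hl', Nat.succ_mul (i + 1)]
        omega
      · simp only [update_apply]
        split_ifs <;> simp_all [List.replicate_succ']
  refine (Runs.push_seq (Runs.push_seq (key _ l _ rfl (by simp [hz]) (by simp [ht]) (by simp [hr])
    _))).conv (by omega) fun k => ?_
  simp only [update_apply]
  split_ifs <;> simp_all

/-- Fill the matrix `m` with as many bits `true` as the binary number on `z` says, or as there is
room for, and bits `false`. -/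
def Prog.fill (m : M) : Prog (Stk X M) :=
  .seq (.copy .t .n .u) (.seq .rows (.seq
    (.loop .p isTok (.decrement (.push (.a m) fun _ => tok) (.push (.a m) fun _ => some false)))
    (.drain .z isBit)))

theorem exists_runs_fill (m : M) {n : ℕ} {l : List Bool} :
    ∃ A : Fin n → Fin n → Prop, size A = min (value l) (n * n) ∧
      ∀ s : Stk X M → List Sym, Clean n s → s .z = l.map some → s (.a m) = [] →
      ∀ r, Runs (.fill m) r s ((n * n) * (4 * l.length + 11) + 9 * n + 2 * l.length + 8)
        (update (update s .z []) (.a m) (cells A)) := by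
  have key : ∀ (i : ℕ) (l : List Bool), ∃ (L : List Sym) (l' : List Bool), L.length = i ∧
      (∀ b ∈ L, ∃ c : Bool, b = some c) ∧ L.count tok = min (value l) i ∧ l'.length ≤ l.length ∧
      ∀ s : Stk X M → List Sym, s .z = l.map some → s .t = [] → s .p = List.replicate i tok → ∀ r,
      Runs (.loop .p isTok
        (.decrement (.push (.a m) fun _ => tok) (.push (.a m) fun _ => some false))) r s
        (i * (4 * l.length + 6) + 1)
        (update (update (update s .z (l'.map some)) .p []) (.a m) (L ++ s (.a m))) := by
    intro i
    induction i with
    | zero =>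
      intro l
      refine ⟨[], l, rfl, by simp, by simp, le_rfl, fun s hz ht hp r => ?_⟩
      refine (Runs.loop_done (s := s) (k := .p) (c := isTok) r (by rw [hp]; rfl)).conv
        (Nat.le_add_left _ _) fun k => ?_
      simp only [update_apply]
      split_ifs <;> simp_all
    | succ i ih =>
      intro l
      by_cases hl : value l = 0
      -- The decrement of zero empties the stack `z`, which still represents zero.
      · obtain ⟨L, l', h1, h2, h3, h4, h5⟩ := ih []
        refine ⟨L ++ [some false], l', by simp [h1], ?_, ?_, h4.trans (by simp),
          fun s hz ht hp r => ?_⟩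
        · intro b hb
          rcases List.mem_append.1 hb with hb | hb
          · exact h2 b hb
          · exact ⟨false, by simpa using hb⟩
        · have : value [] = 0 := rfl
          simp [h3, hl, this]
        · refine (Runs.loop_step r (s := s) (k := .p) (T := 4 * l.length + 1 + 3)
            (s' := update (update (update s .p (List.replicate i tok)) .z []) (.a m)
              (some false :: s (.a m))) (by rw [hp]; rfl)
            (runs_decrement_zero (l := l) (by simp [hz]) (by simp [ht]) hl (fun r =>
              (Runs.push _ _ _ _).conv le_rfl fun k => ?_) _)
            (h5 _ (by simp) (by simp [ht]) (by simp))).conv ?_ fun k => ?_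
          · simp only [update_apply]
            split_ifs <;> simp_all [List.replicate_succ]
          · have : i * (4 * ([] : List Bool).length + 6) ≤ i * (4 * l.length + 6) :=
              Nat.mul_le_mul_left _ (by simp)
            rw [Nat.succ_mul i]
            omega
          · simp only [update_apply]
            split_ifs <;> simp_all
      · obtain ⟨l₁, hl₁, hv, hd⟩ := runs_decrement_succ (X := X) (M := M) hl
        obtain ⟨L, l', h1, h2, h3, h4, h5⟩ := ih l₁
        refine ⟨L ++ [tok], l', by simp [h1], ?_, ?_, h4.trans hl₁.le, fun s hz ht hp r => ?_⟩
        · intro b hb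
          rcases List.mem_append.1 hb with hb | hb
          · exact h2 b hb
          · exact ⟨true, by simpa using hb⟩
        · simp [h3, hv]
        · refine (Runs.loop_step r (s := s) (k := .p) (T := 4 * l.length + 1 + 4)
            (s' := update (update (update s .p (List.replicate i tok)) .z (l₁.map some)) (.a m)
              (tok :: s (.a m))) (by rw [hp]; rfl)
            (hd (by simp [hz]) (by simp [ht]) (fun r =>
              (Runs.push _ _ _ _).conv le_rfl fun k => ?_) _)
            (h5 _ (by simp) (by simp [ht]) (by simp))).conv ?_ fun k => ?_
          · simp only [update_apply]
            split_ifs <;> simp_all [List.replicate_succ]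
          · rw [hl₁, Nat.succ_mul i]
            omega
          · simp only [update_apply]
            split_ifs <;> simp_all
  obtain ⟨L, l', h1, h2, h3, h4, h5⟩ := key (n * n) l
  obtain ⟨A, rfl⟩ := exists_cells_eq h1 h2
  refine ⟨A, by rw [← count_cells, h3], fun s hs hz hm r => ?_⟩
  obtain ⟨hn, hp, hu, ht⟩ := hs
  refine (Runs.seq (runs_copy (j := n) (l := []) (by simp) (by simp) (by simp) (by simp [hn]) ht r)
    fun r => Runs.seq (runs_rows (n := n) (i := n) (by simp [hn]) (by simp [ht]) (by simp [hu]) r)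
    fun r => Runs.seq (h5 _ (by simp [hz]) (by simp [ht]) (by simp [hp]) r) fun r =>
    runs_drain (l := l'.map some) (l' := []) (by simp) (fun b hb => ?_) rfl r).conv ?_ fun k => ?_
  · obtain ⟨c, _, rfl⟩ := List.mem_map.1 hb
    rfl
  · simp only [List.length_map]
    ring_nf
    omega
  · simp only [update_apply]
    split_ifs <;> simp_all

end GraphDuplication

namespace GraphDuplication

open Function

/-! ### Decision procedures from commands -/

variable {X M : Type} [DecidableEq X] [DecidableEq M] [Fintype X] [Fintype M]

/-- The program that turns an input word on the stack `a adj` into the dimension, the adjacency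
matrix (which stays on `a adj`), and matrices `mk`, `ma` with as many cells that hold as `k`, `α`
say, and gives all variables the value `0`. -/
noncomputable def Prog.init (adj mk ma : M) : Prog (Stk X M) :=
  .seq (.readNumber adj) (.seq .unary (.seq (.readNumber adj) (.seq (.fill mk)
    (.seq (.readNumber adj) (.seq (.fill ma)
      (.seq (.forEach .fill (Finset.univ \ {adj, mk, ma}).toList)
        (.forEach (fun x => .push (.v x) fun _ => none) Finset.univ.toList)))))))

/-- Remove everything from the stacks other than `e`. -/
noncomputable def Prog.cleanup : Prog (Stk X M) :=
  .forEach (fun k => .drain k Option.isSome) (Finset.univ \ {Stk.e}).toList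

theorem eval_mono (P : Polynomial ℕ) {a b : ℕ} (h : a ≤ b) : P.eval a ≤ P.eval b := by
  simp only [Polynomial.eval_eq_sum]
  exact Finset.sum_le_sum fun i _ => Nat.mul_le_mul_left _ (Nat.pow_le_pow_left h i)

omit [Fintype X] [Fintype M] in
theorem runs_readNumber_fill {adj m : M} (hne : adj ≠ m) {n : ℕ} {l : List Bool} :
    ∃ A : Fin n → Fin n → Prop, size A = min (value l) (n * n) ∧
      ∀ (s : Stk X M → List Sym) (l' : List Sym), Clean n s → s .z = [] → s .e = [] →
      s (.a adj) = l.map some ++ none :: l' → s (.a m) = [] →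
      ∀ B, n ≤ B → n * n ≤ B → l.length ≤ B →
      ∀ q T s', (∀ r, Runs q r (update (update s (.a adj) l') (.a m) (cells A)) T s') →
      ∀ r, Runs (.seq (.readNumber adj) (.seq (.fill m) q)) r s (4 * (B * B) + 26 * B + 10 + T)
        s' := by
  obtain ⟨A, hA, hr⟩ := exists_runs_fill (X := X) m (n := n) (l := l)
  refine ⟨A, hA, fun s l' hs hz he hadj hm B h1 h2 h3 q T s' hq r => ?_⟩
  refine (Runs.seq (runs_readNumber hadj he hz r) fun r => Runs.seq
    ((hr (update (update s (.a adj) l') .z (l.map some))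
      ⟨by simp [hs.n], by simp [hs.p], by simp [hs.u], by simp [hs.t]⟩ (by simp)
      (by simp [hm, hne.symm]) r).conv le_rfl fun k => ?_) hq).mono ?_
  · simp only [update_apply]
    split_ifs <;> simp_all
  · have : n * n * (4 * l.length + 11) ≤ B * (4 * B + 11) :=
      Nat.mul_le_mul h2 (by omega)
    have e : B * (4 * B + 11) = 4 * (B * B) + 11 * B := by ring
    omega

omit [DecidableEq X] [DecidableEq M] [Fintype X] [Fintype M] in
theorem Instance.length_encode (I : Instance) : I.n * I.n ≤ I.encode.length ∧
    (Computability.encodeNat I.n).length ≤ I.encode.length ∧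
    (Computability.encodeNat I.k).length ≤ I.encode.length ∧
    (Computability.encodeNat I.α).length ≤ I.encode.length := by
  have h := length_cells I.G.Adj
  rw [cells_adj] at h
  simp only [Instance.encode, List.length_append, List.length_cons, h]
  simp only [List.length_map]
  omega

theorem runs_init {adj mk ma : M} (h1 : adj ≠ mk) (h2 : adj ≠ ma) (h3 : mk ≠ ma) (I : Instance)
    (hn : 0 < I.n) : ∃ (A : M → Fin I.n → Fin I.n → Prop) (s : Stk X M → List Sym),
      A adj = I.G.Adj ∧ size (A mk) = min I.k (I.n * I.n) ∧ size (A ma) = min I.α (I.n * I.n) ∧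
      Rep (fun _ => ⟨0, hn⟩) A s ∧ s .e = [] ∧ (∀ k, (s k).length ≤ I.n * I.n + I.n + 1) ∧
      ∀ B, B = I.encode.length → ∀ r,
        Runs (.init adj mk ma) r (update (fun _ => []) (.a adj) I.encode)
          (4 * B + 2 + ((B + 1) * (4 * B + 7) + 3 + (4 * (B * B) + 26 * B + 10 +
            (4 * (B * B) + 26 * B + 10 + (Fintype.card M * (4 * (B * B) + 22 * B + 8) + 1 +
              (Fintype.card X + 1)))))) s := by
  obtain ⟨hl1, hl2, hl3, hl4⟩ := I.length_encode
  obtain ⟨Ak, hAk, hrk⟩ := runs_readNumber_fill (X := X) h1 (n := I.n)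
    (l := Computability.encodeNat I.k)
  obtain ⟨Aα, hAα, hrα⟩ := runs_readNumber_fill (X := X) h2 (n := I.n)
    (l := Computability.encodeNat I.α)
  choose A0 _ hr0' using fun m : M => exists_runs_fill (X := X) m (n := I.n) (l := [])
  have hr0 : ∀ m, ∀ s : Stk X M → List Sym, Clean I.n s → s .z = [] → s (.a m) = [] → ∀ r,
      Runs (.fill m) r s ((I.n * I.n) * 11 + 9 * I.n + 8) (update s (.a m) (cells (A0 m))) := by
    intro m s hs hz hm r
    refine (hr0' m s hs hz hm r).conv (by simp) fun k => ?_
    simp only [update_apply]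
    split_ifs <;> simp_all
  have hsq : I.n ≤ I.n * I.n := Nat.le_mul_self _
  let s₁ : Stk X M → List Sym := update (update (update (update (fun _ => []) .n
    (List.replicate I.n tok ++ [none])) (.a adj) (cells I.G.Adj)) (.a mk) (cells Ak))
    (.a ma) (cells Aα)
  obtain ⟨s₂, ⟨hc₂, hz₂⟩, hm₂, hk₂, hr₂⟩ := runs_forEach (K := Stk X M) (f := Prog.fill)
    (key := Stk.a) (fun _ _ h => by simpa using h) (J := fun s => Clean I.n s ∧ s .z = [])
    (Q := fun m l => l = cells (A0 m)) (T := (I.n * I.n) * 11 + 9 * I.n + 8)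
    (Finset.nodup_toList (Finset.univ \ {adj, mk, ma})) (s := s₁)
    ⟨⟨by simp [s₁], by simp [s₁], by simp [s₁], by simp [s₁]⟩, by simp [s₁]⟩
    fun m hm s hs hsm => ⟨_, ⟨⟨by simp [hs.1.n], by simp [hs.1.p], by simp [hs.1.u],
      by simp [hs.1.t]⟩, by simp [hs.2]⟩, update_self _ _ _, fun k hk => update_of_ne hk _ _,
      hr0 m s hs.1 hs.2 (by
        simp only [Finset.mem_toList, Finset.mem_sdiff, Finset.mem_univ, Finset.mem_insert,
          Finset.mem_singleton, not_or, true_and] at hm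
        simp [hsm, s₁, hm])⟩
  obtain ⟨s₃, -, hm₃, hk₃, hr₃⟩ := runs_forEach (K := Stk X M)
    (f := fun x => .push (.v x) fun _ => none)
    (key := Stk.v) (fun _ _ h => by simpa using h) (J := fun s => True)
    (Q := fun m l => l = [none]) (T := 1)
    (Finset.nodup_toList (Finset.univ : Finset X)) (s := s₂) trivial
    fun x hx s hs hsm => ⟨_, trivial, by
      rw [update_self, hsm, hk₂ _ (by simp)]
      simp [s₁], fun k hk => update_of_ne hk _ _, fun r => Runs.push _ _ _ _⟩
  have hA : ∀ m, ∃ A : Fin I.n → Fin I.n → Prop, s₃ (.a m) = cells A ∧ (m = adj → A = I.G.Adj) ∧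
      (m = mk → A = Ak) ∧ (m = ma → A = Aα) := by
    intro m
    rw [hk₃ _ (by simp)]
    by_cases hm : m = adj ∨ m = mk ∨ m = ma
    · rw [hk₂ _ (by
        simp only [Finset.mem_toList, Finset.mem_sdiff, Finset.mem_univ, Finset.mem_insert,
          Finset.mem_singleton, not_or, true_and, ne_eq, Stk.a.injEq]
        rintro i hi rfl
        tauto)]
      rcases hm with rfl | rfl | rfl
      · exact ⟨I.G.Adj, by simp [s₁, h1, h2], by tauto⟩
      · exact ⟨Ak, by simp [s₁, h3], by tauto⟩
      · exact ⟨Aα, by simp [s₁], by tauto⟩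
    · exact ⟨A0 m, hm₂ m (by simpa using hm), by tauto⟩
  choose A hA1 hA2 hA3 hA4 using hA
  refine ⟨A, s₃, hA2 _ rfl, ?_, ?_, ⟨⟨?_, ?_, ?_, ?_⟩, fun x => ?_, hA1⟩, ?_, fun k => ?_,
    fun B hB r => ?_⟩
  · rw [hA3 _ rfl, hAk, value_encodeNat]
  · rw [hA4 _ rfl, hAα, value_encodeNat]
  · rw [hk₃ _ (by simp), hc₂.n]
  · rw [hk₃ _ (by simp), hc₂.p]
  · rw [hk₃ _ (by simp), hc₂.u]
  · rw [hk₃ _ (by simp), hc₂.t]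
  · exact ⟨[], by simpa using hm₃ x (by simp)⟩
  · rw [hk₃ _ (by simp), hk₂ _ (by simp)]
    simp [s₁]
  · cases k with
    | v x => simp [hm₃ x (by simp)]
    | a m =>
      rw [hA1, length_cells]
      omega
    | n =>
      rw [hk₃ _ (by simp), hk₂ _ (by simp)]
      simp [s₁]
    | _ =>
      rw [hk₃ _ (by simp), hk₂ _ (by simp)]
      simp [s₁]
  · refine (Runs.seq (runs_readNumber (l := Computability.encodeNat I.n)
      (l' := _) (update_self _ _ _) (by simp) (by simp) r) fun r => Runs.seq
      (runs_unary (l := Computability.encodeNat I.n) (by simp) (by simp) (by simp) (by simp) r)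
      (hrk _ ((Computability.encodeNat I.α).map some ++ none :: (adjacencyBits I.G).map some)
        ⟨by simp [value_encodeNat], by simp, by simp, by simp⟩ (by simp) (by simp) (by simp)
        (by simp [h1.symm]) B (by omega) (by omega) (by omega) _ _ _
        (hrα _ ((adjacencyBits I.G).map some)
          ⟨by simp [value_encodeNat], by simp, by simp, by simp⟩ (by simp) (by simp)
          (by simp [h1]) (by simp [h2.symm, h3.symm])
          B (by omega) (by omega) (by omega) _ _ _
          fun r => Runs.seq (T := Fintype.card M * (4 * (B * B) + 22 * B + 8) + 1) ?_
            hr₃))).mono ?_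
    · have h := (hr₂ r).mono (T' := Fintype.card M * (4 * (B * B) + 22 * B + 8) + 1) ?_
      rotate_left
      · refine Nat.add_le_add_right (Nat.mul_le_mul ?_ ?_) 1
        · rw [Finset.length_toList]
          exact Finset.card_le_univ _
        · omega
      · convert h using 1
        funext k
        simp only [s₁, ← cells_adj, update_apply, value_encodeNat]
        clear * - h1 h2 h3
        split_ifs <;> simp_all
    · rw [value_encodeNat, Finset.length_toList, Finset.card_univ]
      have : (I.n + 1) * (4 * (Computability.encodeNat I.n).length + 7) ≤ (B + 1) * (4 * B + 7) :=
        Nat.mul_le_mul (by omega) (by omega)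
      omega

/-- A problem about instances can be decided in polynomial time if a formula expresses it after
the execution of a command. The numbers `k` and `α` are given as the sizes of matrices, hence cut
off at `n * n`; in a comparison with the size of another matrix, this makes no difference. -/
theorem polyTimeDecidableOn_of_cmd {D Q : Instance → Prop} (c : Cmd X M) (φ : Fm X M)
    {adj mk ma : M} (h1 : adj ≠ mk) (h2 : adj ≠ ma) (h3 : mk ≠ ma)
    (h : ∀ I : Instance, D I → ∀ (v : X → Fin I.n) (A : M → Fin I.n → Fin I.n → Prop),
      A adj = I.G.Adj → size (A mk) = min I.k (I.n * I.n) → size (A ma) = min I.α (I.n * I.n) →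
      (φ.Holds (c.eval v A) v ↔ Q I)) : PolyTimeDecidableOn D Q := by
  classical
  obtain ⟨P, hP⟩ := c.runs
  obtain ⟨P', hP'⟩ := φ.runs
  let B : Polynomial ℕ := .X
  refine polyTimeDecidableOn_of_exec
    (.seq (.seq (.init adj mk ma) (.seq c.prog (.seq φ.prog .cleanup))) (.pop .e)) (.a adj)
    ((4 * B + 2 + ((B + 1) * (4 * B + 7) + 3 + (4 * (B * B) + 26 * B + 10 +
            (4 * (B * B) + 26 * B + 10 + ((Fintype.card M : ℕ) * (4 * (B * B) + 22 * B + 8) + 1 +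
              ((Fintype.card X : ℕ) + 1)))))) +
      (P + (P' + ((Fintype.card (Stk X M) : ℕ) * (4 * B + 3) + 1 + 1))))
    fun I hI => ?_
  have hn : 0 < I.n := by
    obtain ⟨a, -⟩ := I.legal.edges_nonempty
    exact Nat.pos_of_ne_zero fun h => by
      have := a.2
      omega
  obtain ⟨hl1, -⟩ := I.length_encode
  have hsq : I.n ≤ I.n * I.n := Nat.le_mul_self _
  obtain ⟨A, s, hA, hk, hα, hs, he, hlen, hr⟩ := runs_init (X := X) h1 h2 h3 I hn
  set v : X → Fin I.n := fun _ => ⟨0, hn⟩ with hv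
  set s₁ := update (withMats s (c.eval v A)) .e [bit (φ.Holds (c.eval v A) v)] with hs₁
  have hlen₁ : ∀ k, (s₁ k).length ≤ I.n * I.n + I.n + 1 := by
    intro k
    cases k with
    | a m =>
      simp [hs₁, withMats]
      omega
    | e => simp [hs₁]
    | _ => simpa [hs₁, withMats] using hlen _
  obtain ⟨s₂, -, hQ₂, hk₂, hr₂⟩ := runs_forEach (K := Stk X M)
    (f := fun k => .drain k Option.isSome)
    (key := id) injective_id (J := fun s => True)
    (Q := fun m l => l = []) (T := 4 * I.encode.length + 3)
    (Finset.nodup_toList (Finset.univ \ {Stk.e} : Finset (Stk X M))) (s := s₁) trivial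
    fun k hk s hs hsm => ⟨_, trivial, update_self _ _ _, fun k hk => update_of_ne hk _ _,
      fun r => (runs_drain (l := s k) (l' := []) (by simp) (by simp) rfl r).mono (by
        have := hlen₁ k
        rw [show s k = s₁ k from hsm]
        omega)⟩
  have hfin : Runs (.seq (.init adj mk ma) (.seq c.prog (.seq φ.prog .cleanup))) none
    (update (fun _ => []) (.a adj) I.encode) _ s₂ :=
    Runs.seq (hr _ rfl none) fun r => Runs.seq (hP _ v A s r hs) fun r => Runs.seq
      ((hP' _ v _ _ r hs.withMats).conv (s'' := s₁) le_rfl fun k => by simp [hs₁, withMats, he]) hr₂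
  obtain ⟨r', t, ht, hex⟩ := hfin
  refine ⟨t + 1, ?_, decide (φ.Holds (c.eval v A) v), ?_, ?_⟩
  · have e1 := eval_mono P (hsq.trans hl1)
    have e2 := eval_mono P' (hsq.trans hl1)
    have e3 : (Finset.univ \ {Stk.e} : Finset (Stk X M)).toList.length *
        (4 * I.encode.length + 3) ≤ Fintype.card (Stk X M) * (4 * I.encode.length + 3) := by
      rw [Finset.length_toList]
      exact Nat.mul_le_mul_right _ (Finset.card_le_univ _)
    simp only [B, Polynomial.eval_add, Polynomial.eval_mul, Polynomial.eval_X,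
      Polynomial.eval_natCast, Nat.cast_id, Polynomial.eval_ofNat, Polynomial.eval_one]
    omega
  · rw [decide_eq_true_iff]
    exact h I hI v A hA hk hα
  · have e1 : s₂ .e = [bit (φ.Holds (c.eval v A) v)] := by
      rw [hk₂ _ (by simp only [Finset.mem_toList, Finset.mem_sdiff, Finset.mem_univ,
        Finset.mem_singleton, true_and, id, ne_eq]; exact fun _ h h' => h h'.symm), hs₁,
        update_self]
    convert hex.seq (Exec.pop Stk.e r' s₂) using 1
    · rw [e1]
      by_cases hφ : φ.Holds (c.eval v A) v <;> simp [bit, hφ]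
    · funext k
      by_cases hk : k = .e
      · subst hk
        simp [e1]
      · rw [update_of_ne hk]
        exact (hQ₂ k (by simpa using hk)).symm

end GraphDuplication

namespace GraphDuplication

open Function Relation

/-! ### Assignments, transitive closure, and search -/

section Commands

variable {X M : Type} [DecidableEq X] [DecidableEq M]

/-- Disjunction. -/
def Fm.or (φ ψ : Fm X M) : Fm X M := .not (.and (.not φ) (.not ψ))

/-- Disjunction of a family of formulas; the matrix `m` only serves to express falsity. -/
def Fm.any {ι : Type} (m : M) (φ : ι → Fm X M) : List ι → Fm X M
  | [] => .not (.le m m)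
  | i :: l => .or (φ i) (Fm.any m φ l)

omit [DecidableEq M] in
@[simp] theorem Fm.holds_or {n : ℕ} {A : M → Fin n → Fin n → Prop} {φ ψ : Fm X M} {v} :
    (Fm.or φ ψ).Holds A v ↔ φ.Holds A v ∨ ψ.Holds A v := by
  simp only [Fm.or, Fm.Holds]
  tauto

omit [DecidableEq M] in
@[simp] theorem Fm.holds_any {n : ℕ} {A : M → Fin n → Fin n → Prop} {ι : Type} {m : M}
    {φ : ι → Fm X M} {l : List ι} {v} :
    (Fm.any m φ l).Holds A v ↔ ∃ i ∈ l, (φ i).Holds A v := by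
  induction l with
  | nil => simp [Fm.any, Fm.Holds]
  | cons i l ih => simp [Fm.any, ih]

/-- Set all cells of a matrix, by a formula in the row `x` and the column `y`. -/
def Cmd.assign (m : M) (x y : X) (φ : Fm X M) : Cmd X M := .loop x (.loop y (.set m x y φ))

theorem Cmd.eval_assign {n : ℕ} {m : M} {x y : X} (hxy : x ≠ y) {φ : Fm X M} {v : X → Fin n}
    {A : M → Fin n → Fin n → Prop}
    (hφ : ∀ B w, φ.Holds (update A m B) w ↔ φ.Holds A w) :
    (Cmd.assign m x y φ).eval v A =
      update A m fun i j => φ.Holds A (update (update v x i) y j) := by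
  have h1 : ∀ (i : Fin n) B, (Cmd.loop y (.set m x y φ)).eval (update v x i) (update A m B) =
      update A m fun i' j => (i' = i ∧ φ.Holds A (update (update v x i) y j)) ∨
        (i' ≠ i ∧ B i' j) := by
    intro i B
    have := iterTo_induction (n := n)
      (f := fun j => (Cmd.set m x y φ).eval (update (update v x i) y j)) (a := update A m B)
      (fun k C => C = update A m fun i' j =>
        ((i' = i ∧ (j : ℕ) < k) ∧ φ.Holds A (update (update v x i) y j)) ∨
          (¬(i' = i ∧ (j : ℕ) < k) ∧ B i' j)) (by simp) ?_
    · refine Eq.trans this ?_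
      congr 1
      funext i' j
      simp
    · rintro j _ rfl
      simp only [Cmd.eval, update_idem, update_self, hφ, update_of_ne hxy]
      congr 1
      funext i' j'
      rw [eq_iff_iff, setCell]
      rcases eq_or_ne j' j with rfl | hj
      · simp
      · have : (j' : ℕ) < j + 1 ↔ (j' : ℕ) < j := by
          have : (j' : ℕ) ≠ j := fun h => hj (Fin.ext h)
          omega
        simp [this, hj]
  have := iterTo_induction (n := n)
    (f := fun i => (Cmd.loop y (.set m x y φ)).eval (update v x i)) (a := A)
    (fun k C => C = update A m fun i j =>
      ((i : ℕ) < k ∧ φ.Holds A (update (update v x i) y j)) ∨ (¬(i : ℕ) < k ∧ A m i j)) (by simp) ?_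
  · refine Eq.trans this ?_
    congr 1
    funext i j
    simp
  · rintro i _ rfl
    rw [h1]
    congr 1
    funext i' j'
    rw [eq_iff_iff]
    rcases eq_or_ne i' i with rfl | hi
    · simp
    · have : (i' : ℕ) < i + 1 ↔ (i' : ℕ) < i := by
        have : (i' : ℕ) ≠ i := fun h => hi (Fin.ext h)
        omega
      simp [this, hi]

/-- Replace the relation `m` by its transitive closure, by means of the auxiliary matrix `tmp`:
for every `z` in turn, add all pairs that are linked via `z`. -/
def Cmd.close (m tmp : M) (x y z : X) : Cmd X M :=
  .loop z (.seq (.assign tmp x y (.rel m x y))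
    (.assign m x y (.or (.rel tmp x y) (.and (.rel tmp x z) (.rel tmp z y)))))

theorem Cmd.eval_close {n : ℕ} {m tmp : M} (hm : m ≠ tmp) {x y z : X} (hxy : x ≠ y) (hxz : x ≠ z)
    (hyz : y ≠ z) {v : X → Fin n} {A : M → Fin n → Fin n → Prop} :
    (Cmd.close m tmp x y z).eval v A m = TransGen (A m) ∧
      ∀ m', m' ≠ m → m' ≠ tmp → (Cmd.close m tmp x y z).eval v A m' = A m' := by
  have := iterTo_induction (n := n) (f := fun k =>
    (Cmd.seq (.assign tmp x y (.rel m x y))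
      (.assign m x y (.or (.rel tmp x y) (.and (.rel tmp x z) (.rel tmp z y))))).eval
      (update v z k)) (a := A)
    (fun k B => (∀ m', m' ≠ m → m' ≠ tmp → B m' = A m') ∧ (∀ i j, A m i j → B m i j) ∧
      (∀ i j, B m i j → TransGen (A m) i j) ∧
      ∀ l : Fin n, (l : ℕ) < k → ∀ i j, B m i l → B m l j → B m i j) (by simp +contextual
        [TransGen.single]) ?_
  · obtain ⟨h1, h2, h3, h4⟩ := this
    refine ⟨?_, h1⟩
    funext i j
    refine propext ⟨h3 i j, fun h => ?_⟩
    induction h with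
    | single h => exact h2 _ _ h
    | tail _ h ih => exact h4 _ (Fin.is_lt _) _ _ ih (h2 _ _ h)
  · rintro k B ⟨h1, h2, h3, h4⟩
    have e1 := Cmd.eval_assign hxy (v := update v z k) (A := B) (m := tmp) (φ := .rel m x y)
      (fun C w => by simp [Fm.Holds, hm])
    have e2 := Cmd.eval_assign hxy (v := update v z k) (A := update B tmp (B m)) (m := m)
      (φ := .or (.rel tmp x y) (.and (.rel tmp x z) (.rel tmp z y)))
      (fun C w => by simp [Fm.Holds, hm.symm])
    simp only [Fm.Holds, Fm.holds_or, update_self, update_of_ne hxy, update_of_ne hxz.symm,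
      update_of_ne hyz.symm] at e1 e2
    have e3 : (Cmd.seq (.assign tmp x y (.rel m x y)) (.assign m x y
        (.or (.rel tmp x y) (.and (.rel tmp x z) (.rel tmp z y))))).eval (update v z k) B =
        update (update B tmp (B m)) m fun i j => B m i j ∨ (B m i k ∧ B m k j) := by
      rw [← e2, ← show (fun i j => B m i j) = B m from rfl, ← e1]
      rfl
    rw [e3]
    refine ⟨fun m' hm' hm'' => ?_, ?_, ?_, ?_⟩
    · rw [update_of_ne hm', update_of_ne hm'', h1 m' hm' hm'']
    · simp only [update_self]
      exact fun i j h => Or.inl (h2 i j h)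
    · simp only [update_self]
      rintro i j (h | ⟨h, h'⟩)
      · exact h3 i j h
      · exact (h3 _ _ h).trans (h3 _ _ h')
    · simp only [update_self]
      intro l hl i j
      rcases Nat.lt_succ_iff_lt_or_eq.1 hl with hl | hl
      · have := h4 l hl
        rintro (h | ⟨h, h'⟩) (g | ⟨g, g'⟩)
        · exact Or.inl (this _ _ h g)
        · exact Or.inr ⟨this _ _ h g, g'⟩
        · exact Or.inr ⟨h, this _ _ h' g⟩
        · exact Or.inr ⟨h, g'⟩
      · obtain rfl : l = k := Fin.ext hl
        rintro (h | ⟨h, h'⟩) (g | ⟨g, g'⟩)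
        · exact Or.inr ⟨h, g⟩
        · exact Or.inr ⟨h, g'⟩
        · exact Or.inr ⟨h, g⟩
        · exact Or.inr ⟨h, g'⟩

/-- Nested loops over the variables in a list. -/
def Cmd.loops (l : List X) (c : Cmd X M) : Cmd X M := l.foldr Cmd.loop c

/-- If a command records in `res` whether the variables satisfy `Φ`, then nested loops find out
whether there are such values of the variables. -/
theorem Cmd.eval_loops {n : ℕ} {c : Cmd X M} {I res : (M → Fin n → Fin n → Prop) → Prop}
    {Φ : (X → Fin n) → Prop}
    (hc : ∀ v A, I A → I (c.eval v A) ∧ (res (c.eval v A) ↔ res A ∨ Φ v)) (l : List X)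
    (v : X → Fin n) (A : M → Fin n → Fin n → Prop) (hA : I A) :
    I ((Cmd.loops l c).eval v A) ∧ (res ((Cmd.loops l c).eval v A) ↔
      res A ∨ ∃ w, (∀ x ∉ l, w x = v x) ∧ Φ w) := by
  induction l generalizing v A with
  | nil =>
    have : (∃ w : X → Fin n, (∀ x ∉ ([] : List X), w x = v x) ∧ Φ w) ↔ Φ v := by
      constructor
      · rintro ⟨w, hw, h⟩
        rwa [← show w = v from funext fun x => hw x (by simp)]
      · exact fun h => ⟨v, by simp, h⟩
    rw [this]
    exact hc v A hA
  | cons x l ih =>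
    have := iterTo_induction (n := n) (f := fun i => (Cmd.loops l c).eval (update v x i)) (a := A)
      (fun k B => I B ∧ (res B ↔ res A ∨ ∃ i : Fin n, (i : ℕ) < k ∧
        ∃ w, (∀ x' ∉ l, w x' = update v x i x') ∧ Φ w)) ⟨hA, by simp⟩ ?_
    · refine ⟨this.1, this.2.trans (or_congr_right ?_)⟩
      constructor
      · rintro ⟨i, -, w, hw, h⟩
        refine ⟨w, fun x' hx' => ?_, h⟩
        rw [List.mem_cons, not_or] at hx'
        rw [hw x' hx'.2, update_of_ne hx'.1]
      · rintro ⟨w, hw, h⟩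
        refine ⟨w x, Fin.is_lt _, w, fun x' hx' => ?_, h⟩
        by_cases hxx : x' = x
        · rw [hxx, update_self]
        · rw [update_of_ne hxx, hw x' (by simp [hxx, hx'])]
    · rintro i B ⟨hB, h⟩
      obtain ⟨h1, h2⟩ := ih (update v x i) B hB
      refine ⟨h1, h2.trans ?_⟩
      rw [h, or_assoc]
      refine or_congr_right ?_
      constructor
      · rintro (⟨j, hj, hw⟩ | hw)
        · exact ⟨j, by omega, hw⟩
        · exact ⟨i, by omega, hw⟩
      · rintro ⟨j, hj, hw⟩
        rcases Nat.lt_succ_iff_lt_or_eq.1 hj with hj | hj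
        · exact Or.inl ⟨j, hj, hw⟩
        · obtain rfl : j = i := Fin.ext hj
          exact Or.inr hw

end Commands

theorem transGen_or_eq {V : Type*} {R : V → V → Prop} :
    TransGen (fun x y => R x y ∨ x = y) = ReflTransGen R := by
  funext x y
  refine propext ⟨fun h => ?_, fun h => ?_⟩
  · induction h with
    | single h =>
      rcases h with h | rfl
      · exact .single h
      · exact .refl
    | tail _ h ih =>
      rcases h with h | rfl
      · exact ih.tail h
      · exact ih
  · induction h with
    | refl => exact .single (Or.inr rfl)
    | tail _ h ih => exact ih.tail (Or.inl h)

/-! ### The algorithm -/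

/-- What is left of the edges of `G` when the edges among the pairs `(a i, b i)` are cut. -/
def Uncut {V : Type*} {β : ℕ} (G : Digraph V) (a b : Fin β → V) (x y : V) : Prop :=
  G.Adj x y ∧ ¬∃ i, x = a i ∧ y = b i

/-- The vertices `x` and `y` are linked by a path that may use edges in both directions. -/
def Linked {V : Type*} (H : V → V → Prop) : V → V → Prop :=
  ReflTransGen fun x y => H x y ∨ H y x

/-- The pairs that count the inputs of the cluster that contains the vertices linked by uncut edges
to a vertex `m j` with `l j = l i`: an input `v` of `G` is counted by `(v, v)`, and the new vertex
at the head of a cut edge `e` by `e`. -/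
def inputTokens {V : Type*} {β r : ℕ} (G : Digraph V) (a b : Fin β → V) (l m : Fin r → V)
    (i : Fin r) : Set (V × V) :=
  {p | (∃ j, l i = l j ∧ Linked (Uncut G a b) p.2 (m j)) ∧
    (p.1 = p.2 ∧ (¬∃ u, G.Adj u p.2) ∨ G.Adj p.1 p.2 ∧ ¬Uncut G a b p.1 p.2)}

/-- Vertices that describe a solution: the edges among the pairs `(a i, b i)` are duplicated, and
the component of `m i` belongs to the cluster with the name `l i`. Every component has to be the
component of some `m i`, possibly of several ones, even in different clusters. -/
structure IsCertificate {V : Type*} {β r : ℕ} (G : Digraph V) (k α : ℕ) (a b : Fin β → V)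
    (l m : Fin r → V) : Prop where
  card_names : {p : V × V | p.1 = p.2 ∧ ∃ i, p.1 = l i}.ncard ≤ α
  card_inputs : ∀ i, (inputTokens G a b l m i).ncard ≤ k
  cover : ∀ y, ∃ i, Linked (Uncut G a b) y (m i)
  acceptable : ∀ x, ∃ y z, Linked (Uncut G a b) x y ∧ (¬∃ u, G.Adj u y) ∧ (¬∃ u, G.Adj z u) ∧
    ReflTransGen (Uncut G a b) y z

/-- The variables of the algorithm: a certificate and four variables for the formulas. -/
inductive Vr (β r : ℕ) : Type
  | a (i : Fin β)
  | b (i : Fin β)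
  | l (i : Fin r)
  | m (i : Fin r)
  | x
  | y
  | z
  | u
  deriving DecidableEq, Fintype

/-- The matrices of the algorithm: `adj`, `k`, `α` hold the input, `eq` is the equality of vertices,
`res` records the answer, and the others hold the relations between vertices that occur in
`IsCertificate`. -/
inductive Mt (r : ℕ) : Type
  | adj
  | k
  | α
  | eq
  | res
  | uncut
  | path
  | linked
  | names
  | inputs (i : Fin r)
  | tmp
  deriving DecidableEq, Fintype

section Body

variable {β r : ℕ}

/-- `(x, y)` is an edge that is not cut. -/
def uncutFm : Fm (Vr β r) (Mt r) :=
  .and (.rel .adj .x .y) (.not (.any .adj (fun i => .and (.rel .eq .x (.a i)) (.rel .eq .y (.b i)))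
    (List.finRange β)))

/-- `x = y` is a name. -/
def namesFm : Fm (Vr β r) (Mt r) :=
  .and (.rel .eq .x .y) (.any .adj (fun i => .rel .eq .x (.l i)) (List.finRange r))

/-- `(x, y)` counts an input of the cluster with the name `l i`. -/
def inputsFm (i : Fin r) : Fm (Vr β r) (Mt r) :=
  .and (.any .adj (fun j => .and (.rel .eq (.l i) (.l j)) (.rel .linked .y (.m j)))
      (List.finRange r))
    (.or (.and (.rel .eq .x .y) (.not (.ex .u (.rel .adj .u .y))))
      (.and (.rel .adj .x .y) (.not (.rel .uncut .x .y))))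

/-- The conditions of `IsCertificate`. -/
def certFm : Fm (Vr β r) (Mt r) :=
  .and (.le .names .α) (.and
    (.not (.any .adj (fun i => .not (.le (.inputs i) .k)) (List.finRange r))) (.and
    (.not (.ex .y (.not (.any .adj (fun i => .rel .linked .y (.m i)) (List.finRange r)))))
    (.not (.ex .x (.not (.ex .y (.ex .z (.and (.rel .linked .x .y) (.and
      (.not (.ex .u (.rel .adj .u .y))) (.and (.not (.ex .u (.rel .adj .z .u)))
      (.rel .path .y .z)))))))))))

/-- Compute the matrices `inputs i`, for all `i` in a list. There is no empty command, so the
empty list gets an assignment to `tmp`. -/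
def inputsCmd : List (Fin r) → Cmd (Vr β r) (Mt r)
  | [] => .assign .tmp .x .y (.rel .adj .x .y)
  | i :: L => .seq (.assign (.inputs i) .x .y (inputsFm i)) (inputsCmd L)

/-- Check whether the current values of the variables form a certificate. -/
def checkCmd : Cmd (Vr β r) (Mt r) :=
  .seq (.assign .uncut .x .y uncutFm) <|
  .seq (.assign .path .x .y (.or (.rel .uncut .x .y) (.rel .eq .x .y))) <|
  .seq (.close .path .tmp .x .y .z) <|
  .seq (.assign .linked .x .y
    (.or (.or (.rel .uncut .x .y) (.rel .uncut .y .x)) (.rel .eq .x .y))) <|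
  .seq (.close .linked .tmp .x .y .z) <|
  .seq (.assign .names .x .y namesFm) <|
  .seq (inputsCmd (List.finRange r)) <|
  .seq (.assign .tmp .x .y (.rel .res .x .y)) <|
  .assign .res .x .y (.or (.rel .tmp .x .y) certFm)

/-- Search for a certificate, by nested loops over all variables. Before that, `eq` is made the
equality of vertices, by setting the diagonal of an empty matrix. -/
noncomputable def searchCmd : Cmd (Vr β r) (Mt r) :=
  .seq (.assign .eq .x .y (.not (.le .adj .adj))) <|
  .seq (.loop .x (.set .eq .x .x (.le .adj .adj))) <|
  .seq (.assign .res .x .y (.not (.le .adj .adj))) <|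
  .loops Finset.univ.toList checkCmd

theorem eval_inputsCmd {n : ℕ} (L : List (Fin r)) (v : Vr β r → Fin n)
    (A : Mt r → Fin n → Fin n → Prop) :
    (∀ i ∈ L, (inputsCmd L).eval v A (.inputs i) =
      fun x y => (inputsFm i).Holds A (update (update v .x x) .y y)) ∧
      ∀ m', m' ≠ .tmp → (∀ i ∈ L, m' ≠ .inputs i) → (inputsCmd L).eval v A m' = A m' := by
  have hI : ∀ (i j : Fin r) (B : Mt r → Fin n → Fin n → Prop) C (w : Vr β r → Fin n),
      (inputsFm i).Holds (update B (.inputs j) C) w ↔ (inputsFm i).Holds B w := by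
    intro i j B C w
    simp [inputsFm, Fm.Holds]
  induction L generalizing A with
  | nil =>
    refine ⟨by simp, fun m' hm' _ => ?_⟩
    simp only [inputsCmd]
    rw [Cmd.eval_assign (by simp) (by simp [Fm.Holds]), update_of_ne hm']
  | cons i L ih =>
    have e : (Cmd.assign (.inputs i) .x .y (inputsFm i)).eval v A = _ :=
      Cmd.eval_assign (by simp) (hI i i A)
    simp only [inputsCmd, Cmd.eval, e]
    obtain ⟨h1, h2⟩ := ih (update A (.inputs i) fun x y =>
      (inputsFm i).Holds A (update (update v .x x) .y y))
    refine ⟨fun j hj => ?_, fun m' hm' hm => ?_⟩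
    · by_cases hj' : j ∈ L
      · rw [h1 j hj']
        simp only [hI]
      · obtain rfl : j = i := by simpa [hj'] using hj
        rw [h2 _ (by simp) (fun k hk h => hj' (by cases h; exact hk)), update_self]
    · rw [h2 m' hm' fun j hj => hm j (by simp [hj]), update_of_ne (hm i (by simp))]

/-- The input is in place, and `eq` is the equality of vertices. -/
def Ready {n : ℕ} (G : Digraph (Fin n)) (k α : ℕ) (A : Mt r → Fin n → Fin n → Prop) : Prop :=
  A .adj = G.Adj ∧ A .eq = (· = ·) ∧ size (A .k) = min k (n * n) ∧ size (A .α) = min α (n * n)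

theorem size_le {n : ℕ} (R : Fin n → Fin n → Prop) : size R ≤ n * n := by
  refine (Set.ncard_le_card _).trans ?_
  simp

/-- One check adds the truth of `IsCertificate` to the answer in `res`. -/
theorem eval_checkCmd {n : ℕ} {G : Digraph (Fin n)} {k α : ℕ} (x₀ y₀ : Fin n) (v : Vr β r → Fin n)
    (A : Mt r → Fin n → Fin n → Prop) (hA : Ready G k α A) :
    Ready G k α (checkCmd.eval v A) ∧ (checkCmd.eval v A .res x₀ y₀ ↔ A .res x₀ y₀ ∨
      IsCertificate G k α (v ∘ .a) (v ∘ .b) (v ∘ .l) (v ∘ .m)) := by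
  obtain ⟨hadj, heq, hk, hα⟩ := hA
  simp only [checkCmd, Cmd.eval]
  set A1 := (Cmd.assign .uncut .x .y uncutFm).eval v A with e1
  set A2 := (Cmd.assign .path .x .y (.or (.rel .uncut .x .y) (.rel .eq .x .y))).eval v A1 with e2
  set A3 := (Cmd.close .path .tmp .x .y .z).eval v A2 with e3
  set A4 := (Cmd.assign .linked .x .y
    (.or (.or (.rel .uncut .x .y) (.rel .uncut .y .x)) (.rel .eq .x .y))).eval v A3 with e4
  set A5 := (Cmd.close .linked .tmp .x .y .z).eval v A4 with e5
  set A6 := (Cmd.assign .names .x .y namesFm).eval v A5 with e6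
  set A7 := (inputsCmd (List.finRange r)).eval v A6 with e7
  set A8 := (Cmd.assign .tmp .x .y (.rel .res .x .y)).eval v A7 with e8
  rw [Cmd.eval_assign (by simp) (by simp [uncutFm, Fm.Holds])] at e1
  rw [Cmd.eval_assign (by simp) (by simp [Fm.Holds])] at e2
  rw [Cmd.eval_assign (by simp) (by simp [Fm.Holds])] at e4
  rw [Cmd.eval_assign (by simp) (by simp [namesFm, Fm.Holds])] at e6
  rw [Cmd.eval_assign (by simp) (by simp [Fm.Holds])] at e8
  obtain ⟨h3, h3'⟩ := Cmd.eval_close (m := Mt.path) (tmp := .tmp) (by simp) (x := Vr.x (β := β))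
    (y := .y) (z := .z) (by simp) (by simp) (by simp) (v := v) (A := A2)
  obtain ⟨h5, h5'⟩ := Cmd.eval_close (m := Mt.linked) (tmp := .tmp) (by simp) (x := Vr.x (β := β))
    (y := .y) (z := .z) (by simp) (by simp) (by simp) (v := v) (A := A4)
  obtain ⟨h7, h7'⟩ := eval_inputsCmd (List.finRange r) v A6
  rw [← e3] at h3 h3'
  rw [← e5] at h5 h5'
  rw [← e7] at h7 h7'
  rw [Cmd.eval_assign (by simp) (by simp [certFm, Fm.Holds])]
  -- `A1`, …, `A8` agree with `A` on the input, the equality, and the answer.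
  have hkeep : ∀ m', m' ∈ [Mt.adj, .k, .α, .eq, .res] → A8 m' = A m' := by
    intro m' hm'
    have : m' ≠ .uncut ∧ m' ≠ .path ∧ m' ≠ .linked ∧ m' ≠ .names ∧ m' ≠ .tmp ∧
        ∀ i, m' ≠ .inputs i := by
      simp only [List.mem_cons, List.not_mem_nil, or_false] at hm'
      rcases hm' with rfl | rfl | rfl | rfl | rfl <;> simp
    obtain ⟨k1, k2, k3, k4, k5, k6⟩ := this
    rw [e8, update_of_ne k5, h7' m' k5 fun i _ => k6 i, e6, update_of_ne k4, h5' m' k3 k5, e4,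
      update_of_ne k3, h3' m' k2 k5, e2, update_of_ne k2, e1, update_of_ne k1]
  have hU : A1 .uncut = Uncut G (v ∘ .a) (v ∘ .b) := by
    rw [e1]
    funext i j
    simp [uncutFm, Fm.Holds, Uncut, hadj, heq]
  have hP : A8 .path = ReflTransGen (Uncut G (v ∘ .a) (v ∘ .b)) := by
    have : A2 .path = fun i j => Uncut G (v ∘ .a) (v ∘ .b) i j ∨ i = j := by
      rw [e2]
      funext i j
      have : A1 .eq = (· = ·) := by rw [e1, update_of_ne (by simp), heq]
      simp [Fm.Holds, hU, this]
    rw [e8, update_of_ne (by simp), h7' _ (by simp) (by simp), e6, update_of_ne (by simp),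
      h5' _ (by simp) (by simp), e4, update_of_ne (by simp), h3, this, transGen_or_eq]
  have hU3 : A3 .uncut = Uncut G (v ∘ .a) (v ∘ .b) := by
    rw [h3' _ (by simp) (by simp), e2, update_of_ne (by simp), hU]
  have heq3 : A3 .eq = (· = ·) := by
    rw [h3' _ (by simp) (by simp), e2, update_of_ne (by simp), e1, update_of_ne (by simp), heq]
  have hL5 : A5 .linked = Linked (Uncut G (v ∘ .a) (v ∘ .b)) := by
    have : A4 .linked = fun i j => (Uncut G (v ∘ .a) (v ∘ .b) i j ∨
        Uncut G (v ∘ .a) (v ∘ .b) j i) ∨ i = j := by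
      rw [e4]
      funext i j
      simp [Fm.Holds, hU3, heq3]
    rw [h5, this, transGen_or_eq]
    rfl
  have heq5 : A5 .eq = (· = ·) := by
    rw [h5' _ (by simp) (by simp), e4, update_of_ne (by simp), heq3]
  have hL : A8 .linked = Linked (Uncut G (v ∘ .a) (v ∘ .b)) := by
    rw [e8, update_of_ne (by simp), h7' _ (by simp) (by simp), e6, update_of_ne (by simp), hL5]
  have hN : A8 .names = fun i j => i = j ∧ ∃ q, i = v (.l q) := by
    rw [e8, update_of_ne (by simp), h7' _ (by simp) (by simp), e6, update_self]
    funext i j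
    simp [namesFm, Fm.Holds, heq5]
  have hI : ∀ q, A8 (.inputs q) = fun i j =>
      (i, j) ∈ inputTokens G (v ∘ .a) (v ∘ .b) (v ∘ .l) (v ∘ .m) q := by
    intro q
    rw [e8, update_of_ne (by simp), h7 q (by simp)]
    funext i j
    have h1 : A6 .uncut = Uncut G (v ∘ .a) (v ∘ .b) := by
      rw [e6, update_of_ne (by simp), h5' _ (by simp) (by simp), e4, update_of_ne (by simp), hU3]
    have h2 : A6 .adj = G.Adj := by
      rw [e6, update_of_ne (by simp), h5' _ (by simp) (by simp), e4, update_of_ne (by simp),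
        h3' _ (by simp) (by simp), e2, update_of_ne (by simp), e1, update_of_ne (by simp), hadj]
    have h3 : A6 .eq = (· = ·) := by rw [e6, update_of_ne (by simp), heq5]
    have h4 : A6 .linked = Linked (Uncut G (v ∘ .a) (v ∘ .b)) := by
      rw [e6, update_of_ne (by simp), hL5]
    simp [inputsFm, Fm.Holds, inputTokens, h1, h2, h3, h4]
  have hT : A8 .tmp = A .res := by
    rw [e8, update_self]
    funext i j
    rw [← hkeep .res (by simp), e8, update_of_ne (by simp)]
    simp [Fm.Holds]
  refine ⟨⟨?_, ?_, ?_, ?_⟩, ?_⟩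
  · rw [update_of_ne (by simp), hkeep _ (by simp), hadj]
  · rw [update_of_ne (by simp), hkeep _ (by simp), heq]
  · rw [update_of_ne (by simp), hkeep _ (by simp), hk]
  · rw [update_of_ne (by simp), hkeep _ (by simp), hα]
  rw [update_self, Fm.holds_or]
  refine or_congr (by simp [Fm.Holds, hT]) ?_
  have hle : ∀ {R : Fin n → Fin n → Prop} {K : ℕ}, size R ≤ min K (n * n) ↔ size R ≤ K :=
    fun {R K} => ⟨fun h => h.trans (min_le_left _ _), fun h => le_min h (size_le R)⟩
  simp only [certFm, Fm.Holds, Fm.holds_any, hkeep .adj (by simp), hkeep .k (by simp),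
    hkeep .α (by simp), hP, hL, hN, hI, hadj, hk, hα, hle]
  constructor
  · rintro ⟨c1, c2, c3, c4⟩
    refine ⟨?_, ?_, ?_, ?_⟩
    · simpa [size] using c1
    · simpa [size] using c2
    · simpa using c3
    · simpa using c4
  · rintro ⟨c1, c2, c3, c4⟩
    refine ⟨?_, ?_, ?_, ?_⟩
    · simpa [size] using c1
    · simpa [size] using c2
    · simpa using c3
    · simpa using c4

/-- The search decides whether there is a certificate. -/
theorem eval_searchCmd {n : ℕ} {G : Digraph (Fin n)} {k α : ℕ} (v : Vr β r → Fin n)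
    (A : Mt r → Fin n → Fin n → Prop) (hadj : A .adj = G.Adj) (hk : size (A .k) = min k (n * n))
    (hα : size (A .α) = min α (n * n)) :
    (Fm.rel .res .x .x).Holds (searchCmd.eval v A) v ↔ ∃ a b l m,
      IsCertificate (β := β) (r := r) G k α a b l m := by
  simp only [searchCmd, Cmd.eval, Fm.Holds]
  have e1 : (Cmd.assign .eq .x .y (.not (.le .adj .adj))).eval v A =
      update A .eq fun _ _ => False := by
    rw [Cmd.eval_assign (by simp) (by simp [Fm.Holds])]
    simp [Fm.Holds]
  rw [e1]
  have e2 := iterTo_induction (n := n) (f := fun i (B : Mt r → Fin n → Fin n → Prop) =>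
    update B .eq (setCell (B .eq) (update v .x i .x) (update v .x i .x)
      (size (B .adj) ≤ size (B .adj)))) (a := update A .eq fun _ _ => False)
    (fun k B => B = update A .eq fun i j => i = j ∧ (i : ℕ) < k) (by simp) (by
      rintro i _ rfl
      simp only [update_idem]
      congr 1
      funext x y
      simp only [update_self, le_refl, setCell, eq_iff_iff]
      have : (x : ℕ) < i + 1 ↔ (x : ℕ) < i ∨ x = i := by rw [Nat.lt_succ_iff_lt_or_eq, Fin.ext_iff]
      rw [this]
      by_cases hx : x = i <;> by_cases hy : y = i <;> simp_all [eq_comm])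
  simp only [Fin.is_lt, and_true] at e2
  rw [e2, Cmd.eval_assign (by simp) (by simp [Fm.Holds])]
  set B : Mt r → Fin n → Fin n → Prop := update (update A .eq fun i j => i = j) .res _ with hB
  have hr : ¬ B .res (v .x) (v .x) := by simp [hB, Fm.Holds]
  obtain ⟨-, h⟩ := Cmd.eval_loops (I := Ready G k α) (res := fun A => A .res (v .x) (v .x))
    (fun w B hB => eval_checkCmd (v .x) (v .x) w B hB) (Finset.univ.toList) v B
    (by simp [Ready, hB, hadj, hk, hα])
  refine h.trans ?_
  constructor
  · rintro (h | ⟨w, -, h⟩)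
    · exact absurd h hr
    · exact ⟨_, _, _, _, h⟩
  · rintro ⟨a, b, l, m, h⟩
    refine Or.inr ⟨fun
      | .a i => a i
      | .b i => b i
      | .l i => l i
      | .m i => m i
      | .x => v .x
      | .y => v .x
      | .z => v .x
      | .u => v .x, by simp, h⟩

end Body

end GraphDuplication

namespace GraphDuplication

open Relation

/-! ### Components and degrees after the duplication of edges -/

section Duplicate

variable {V : Type*} {G : Digraph V} {S : Finset (V × V)}

/-- The edges of `G` outside `S`. -/
def Rest (G : Digraph V) (S : Finset (V × V)) (x y : V) : Prop := G.Adj x y ∧ (x, y) ∉ S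

/-- The original vertex to which a vertex of `duplicate G S` is attached. -/
def anchor : V ⊕ (S ⊕ S) → V
  | .inl v => v
  | .inr (.inl e) => e.1.1
  | .inr (.inr e) => e.1.2

/-- The component of a vertex in `duplicate G S`. -/
abbrev comp (G : Digraph V) (S : Finset (V × V)) (v : V) : Component (duplicate G S) :=
  (duplicate G S).toSimpleGraphInclusive.connectedComponentMk (.inl v)

theorem rest_anchor {p q : V ⊕ (S ⊕ S)} (h : (duplicate G S).Adj p q) :
    Rest G S (anchor p) (anchor q) ∨ anchor p = anchor q := by
  match p, q, h with
  | .inl a, .inl b, h => exact Or.inl h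
  | .inl a, .inr (.inl e), h => exact Or.inr (Eq.symm h)
  | .inr (.inr e), .inl b, h => exact Or.inr h

/-- Directed paths between original vertices do not use the new ones. -/
theorem reflTransGen_duplicate {a b : V} :
    ReflTransGen (duplicate G S).Adj (.inl a) (.inl b) ↔ ReflTransGen (Rest G S) a b := by
  constructor
  · intro h
    refine ReflTransGen.lift' (r := (duplicate G S).Adj) anchor (fun p q h => ?_) _ _ h
    rcases rest_anchor h with h | h
    · exact .single h
    · rw [Function.onFun, h]
  · exact ReflTransGen.lift (p := (duplicate G S).Adj) Sum.inl (fun a b h => h) _ _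

theorem reachable_iff_linked {W : Type*} {H : Digraph W} {p q : W} :
    H.toSimpleGraphInclusive.Reachable p q ↔ Linked H.Adj p q := by
  rw [SimpleGraph.reachable_iff_reflTransGen]
  constructor
  · exact ReflTransGen.mono (fun p q h => h.2) _ _
  · intro h
    refine ReflTransGen.lift' id (fun p q h => ?_) _ _ h
    by_cases hpq : p = q
    · subst hpq
      exact .refl
    · exact .single ⟨hpq, h⟩

theorem Linked.symm {H : V → V → Prop} {x y : V} (h : Linked H x y) : Linked H y x :=
  by
  have : Std.Symm fun x y => H x y ∨ H y x := ⟨fun _ _ => Or.symm⟩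
  exact ReflTransGen.stdSymm.symm _ _ h

theorem linked_anchor (p : V ⊕ (S ⊕ S)) :
    Linked (duplicate G S).Adj p (.inl (anchor p)) := by
  match p with
  | .inl a => exact .refl
  | .inr (.inl e) => exact .single (Or.inr rfl)
  | .inr (.inr e) => exact .single (Or.inl rfl)

/-- The new vertices are pendant, so the components of `duplicate G S` are those of the edges
outside `S`. -/
theorem comp_eq_comp {x y : V} : comp G S x = comp G S y ↔ Linked (Rest G S) x y := by
  rw [SimpleGraph.ConnectedComponent.eq, reachable_iff_linked]
  constructor
  · intro h
    refine ReflTransGen.lift' (r := fun p q => (duplicate G S).Adj p q ∨ (duplicate G S).Adj q p)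
      anchor (fun p q h => ?_) _ _ h
    rcases h with h | h <;> rcases rest_anchor h with h | h
    · exact .single (Or.inl h)
    · rw [Function.onFun, h]
    · exact .single (Or.inr h)
    · rw [Function.onFun, h]
  · exact ReflTransGen.lift
      (p := fun p q => (duplicate G S).Adj p q ∨ (duplicate G S).Adj q p) Sum.inl
      (fun a b h => h) _ _

theorem mk_eq_comp_anchor (p : V ⊕ (S ⊕ S)) :
    (duplicate G S).toSimpleGraphInclusive.connectedComponentMk p = comp G S (anchor p) := by
  rw [SimpleGraph.ConnectedComponent.eq, reachable_iff_linked]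
  exact linked_anchor p

theorem exists_eq_comp (c : Component (duplicate G S)) : ∃ v, c = comp G S v := by
  induction c using SimpleGraph.ConnectedComponent.ind with
  | _ p => exact ⟨_, mk_eq_comp_anchor p⟩

theorem mk_eq_mk_of_adj {W : Type*} {H : Digraph W} {p q : W} (h : H.Adj p q) :
    H.toSimpleGraphInclusive.connectedComponentMk p =
      H.toSimpleGraphInclusive.connectedComponentMk q := by
  rw [SimpleGraph.ConnectedComponent.eq, reachable_iff_linked]
  exact .single (Or.inl h)

theorem inDegree_cluster {W : Type*} {H : Digraph W} {C : Set (Component H)}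
    (p : {v : W // H.toSimpleGraphInclusive.connectedComponentMk v ∈ C}) :
    inDegree (cluster H C) p = inDegree H p.1 := by
  unfold inDegree
  refine Set.ncard_congr (fun q _ => q.1) (fun q hq => hq) (fun q q' _ _ h => Subtype.ext h) ?_
  intro q hq
  exact ⟨⟨q, by rw [mk_eq_mk_of_adj hq]; exact p.2⟩, hq, rfl⟩

theorem outDegree_cluster {W : Type*} {H : Digraph W} {C : Set (Component H)}
    (p : {v : W // H.toSimpleGraphInclusive.connectedComponentMk v ∈ C}) :
    outDegree (cluster H C) p = outDegree H p.1 := by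
  unfold outDegree
  refine Set.ncard_congr (fun q _ => q.1) (fun q hq => hq) (fun q q' _ _ h => Subtype.ext h) ?_
  intro q hq
  exact ⟨⟨q, by rw [← mk_eq_mk_of_adj hq]; exact p.2⟩, hq, rfl⟩

variable (hS : ∀ e ∈ S, G.Adj e.1 e.2)
include hS

theorem inDegree_duplicate_inl (v : V) : inDegree (duplicate G S) (.inl v) = inDegree G v := by
  classical
  unfold inDegree
  symm
  refine Set.ncard_congr (fun u _ => if h : (u, v) ∈ S then .inr (.inr ⟨(u, v), h⟩) else .inl u)
    (fun u hu => ?_) (fun u u' _ _ h => ?_) fun p hp => ?_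
  · by_cases h : (u, v) ∈ S
    · simp [h, duplicate]
    · simpa [h, duplicate] using hu
  · by_cases h1 : (u, v) ∈ S <;> by_cases h2 : (u', v) ∈ S <;> simp_all
  · match p, hp with
    | .inl u, hp => exact ⟨u, hp.1, by simp [show (u, v) ∉ S from hp.2]⟩
    | .inr (.inr e), hp =>
      obtain ⟨⟨u, w⟩, he⟩ := e
      obtain rfl : w = v := hp
      exact ⟨u, hS _ he, by simp [he]⟩

theorem outDegree_duplicate_inl (v : V) : outDegree (duplicate G S) (.inl v) = outDegree G v := by
  classical
  unfold outDegree
  symm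
  refine Set.ncard_congr (fun u _ => if h : (v, u) ∈ S then .inr (.inl ⟨(v, u), h⟩) else .inl u)
    (fun u hu => ?_) (fun u u' _ _ h => ?_) fun p hp => ?_
  · by_cases h : (v, u) ∈ S
    · simp [h, duplicate]
    · simpa [h, duplicate] using hu
  · by_cases h1 : (v, u) ∈ S <;> by_cases h2 : (v, u') ∈ S <;> simp_all
  · match p, hp with
    | .inl u, hp => exact ⟨u, hp.1, by simp [show (v, u) ∉ S from hp.2]⟩
    | .inr (.inl e), hp =>
      obtain ⟨⟨w, u⟩, he⟩ := e
      obtain rfl : w = v := hp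
      exact ⟨u, hS _ he, by simp [he]⟩

omit hS in
theorem inDegree_duplicate_tail (e : S) : inDegree (duplicate G S) (.inr (.inl e)) = 1 := by
  rw [inDegree, Set.ncard_eq_one]
  refine ⟨.inl e.1.1, ?_⟩
  ext p
  match p with
  | .inl a => simp [duplicate, eq_comm]
  | .inr (.inl e) => simp [duplicate]
  | .inr (.inr e) => simp [duplicate]

omit hS in
theorem outDegree_duplicate_tail (e : S) : outDegree (duplicate G S) (.inr (.inl e)) = 0 := by
  have : {u | (duplicate G S).Adj (.inr (.inl e)) u} = ∅ := by
    ext p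
    simp [duplicate]
  rw [outDegree, this, Set.ncard_empty]

omit hS in
theorem inDegree_duplicate_head (e : S) : inDegree (duplicate G S) (.inr (.inr e)) = 0 := by
  have : {u | (duplicate G S).Adj u (.inr (.inr e))} = ∅ := by
    ext p
    match p with
    | .inl a => simp [duplicate]
    | .inr (.inl e) => simp [duplicate]
    | .inr (.inr e) => simp [duplicate]
  rw [inDegree, this, Set.ncard_empty]

omit hS in
theorem outDegree_duplicate_head (e : S) : outDegree (duplicate G S) (.inr (.inr e)) = 1 := by
  rw [outDegree, Set.ncard_eq_one]
  refine ⟨.inl e.1.2, ?_⟩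
  ext p
  match p with
  | .inl a => simp [duplicate, eq_comm]
  | .inr (.inl e) => simp [duplicate]
  | .inr (.inr e) => simp [duplicate]

omit hS in
theorem mem_inputs_iff [Finite V] {v : V} : v ∈ inputs G ↔ ¬∃ u, G.Adj u v := by
  rw [inputs, Set.mem_ofPred_eq, inDegree, Set.ncard_eq_zero, Set.eq_empty_iff_forall_notMem]
  simp

omit hS in
theorem mem_outputs_iff [Finite V] {v : V} : v ∈ outputs G ↔ ¬∃ u, G.Adj v u := by
  rw [outputs, Set.mem_ofPred_eq, outDegree, Set.ncard_eq_zero, Set.eq_empty_iff_forall_notMem]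
  simp

/-- The inputs of a cluster are the inputs of `G` in it, and one for every edge of `S` whose head
lies in it. -/
theorem ncard_inputs_cluster [Finite V] (C : Set (Component (duplicate G S))) :
    (inputs (cluster (duplicate G S) C)).ncard =
      {p : V × V | comp G S p.2 ∈ C ∧ (p.1 = p.2 ∧ (¬∃ u, G.Adj u p.2) ∨ p ∈ S)}.ncard := by
  have hin : ∀ p, p ∈ inputs (cluster (duplicate G S) C) ↔
      inDegree (duplicate G S) p.1 = 0 := fun p => by
    rw [← inDegree_cluster]
    rfl
  refine Set.ncard_congr (fun p _ => match p.1 with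
    | .inl v => (v, v)
    | .inr (.inl e) => e.1
    | .inr (.inr e) => e.1) ?_ ?_ ?_
  · rintro ⟨p, hp⟩ h
    rw [hin] at h
    have hp' : comp G S (anchor p) ∈ C := by rwa [← mk_eq_comp_anchor]
    match p, hp, hp', h with
    | .inl v, _, hp', h =>
      rw [inDegree_duplicate_inl hS] at h
      exact ⟨hp', Or.inl ⟨rfl, mem_inputs_iff.1 h⟩⟩
    | .inr (.inl e), _, _, h => simp [inDegree_duplicate_tail] at h
    | .inr (.inr e), _, hp', _ => exact ⟨hp', Or.inr e.2⟩
  · rintro ⟨p, hp⟩ ⟨q, hq⟩ h h' hpq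
    rw [hin] at h h'
    -- The pairs `(v, v)` are not in `S`, since a loop would enter the input `v`.
    have key : ∀ (v : V) (e : S), inDegree G v = 0 → (v, v) ≠ e.1 := fun v e hv he =>
      mem_inputs_iff.1 hv ⟨v, by simpa [← he] using hS _ e.2⟩
    match p, q, hp, hq, h, h', hpq with
    | .inr (.inl e), _, hp, _, h, _, _ => simp [inDegree_duplicate_tail] at h
    | _, .inr (.inl e), _, hp, _, h, _ => simp [inDegree_duplicate_tail] at h
    | .inl v, .inl w, _, _, _, _, hpq => simp_all
    | .inr (.inr e), .inr (.inr e'), _, _, _, _, hpq =>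
      have : e = e' := Subtype.ext hpq
      simp [this]
    | .inl v, .inr (.inr e), _, _, h, _, hpq =>
      rw [inDegree_duplicate_inl hS] at h
      exact absurd hpq (key v e h)
    | .inr (.inr e), .inl v, _, _, _, h, hpq =>
      rw [inDegree_duplicate_inl hS] at h
      exact absurd hpq.symm (key v e h)
  · rintro ⟨x, y⟩ ⟨hC, ⟨hxy, h⟩ | h⟩
    · obtain rfl : x = y := hxy
      refine ⟨⟨.inl x, hC⟩, ?_, rfl⟩
      rw [hin, inDegree_duplicate_inl hS]
      exact mem_inputs_iff.2 h
    · refine ⟨⟨.inr (.inr ⟨_, h⟩), ?_⟩, ?_, rfl⟩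
      · rw [mk_eq_comp_anchor]
        exact hC
      · rw [hin, inDegree_duplicate_head]

omit hS in
theorem sum_inDegree [Fintype V] : ∑ v, inDegree G v = ∑ v, outDegree G v := by
  classical
  simp only [inDegree, outDegree, Set.ncard_eq_toFinset_card', Set.toFinset_ofPred]
  exact (Finset.sum_card_bipartiteAbove_eq_sum_card_bipartiteBelow G.Adj).symm

/-- Every cluster has as many inputs as outputs, because the in-degrees have the same sum as the
out-degrees, and the duplication of edges preserves the balance at every vertex. -/
theorem ncard_inputs_eq_ncard_outputs [Finite V] (hG : IsLegal G)
    (C : Set (Component (duplicate G S))) :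
    (inputs (cluster (duplicate G S) C)).ncard = (outputs (cluster (duplicate G S) C)).ncard := by
  classical
  have hv : ∀ v, inDegree G v + (if inDegree G v = 0 then 1 else 0) =
      outDegree G v + (if outDegree G v = 0 then 1 else 0) := by
    intro v
    have h1 := hG.outDegree_input v
    have h2 := hG.inDegree_output v
    have h3 := hG.inDegree_eq_outDegree v
    simp only [inputs, outputs, Set.mem_ofPred_eq, Set.mem_union, not_or] at h1 h2 h3
    split_ifs <;> grind
  have hp : ∀ p, inDegree (duplicate G S) p + (if inDegree (duplicate G S) p = 0 then 1 else 0) =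
      outDegree (duplicate G S) p + (if outDegree (duplicate G S) p = 0 then 1 else 0) := by
    intro p
    match p with
    | .inl v =>
      rw [inDegree_duplicate_inl hS, outDegree_duplicate_inl hS]
      exact hv v
    | .inr (.inl e) => simp [inDegree_duplicate_tail, outDegree_duplicate_tail]
    | .inr (.inr e) => simp [inDegree_duplicate_head, outDegree_duplicate_head]
  have := Fintype.ofFinite {p // (duplicate G S).toSimpleGraphInclusive.connectedComponentMk p ∈ C}
  have h := sum_inDegree (G := cluster (duplicate G S) C)
  have h' := Finset.sum_congr (rfl : Finset.univ = Finset.univ) fun p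
    (_ : p ∈ (Finset.univ : Finset {p //
      (duplicate G S).toSimpleGraphInclusive.connectedComponentMk p ∈ C})) => hp p.1
  simp only [← inDegree_cluster, ← outDegree_cluster, Finset.sum_add_distrib, h] at h'
  have h'' := Nat.add_left_cancel h'
  simp only [inputs, outputs, Set.ncard_eq_toFinset_card', Set.toFinset_ofPred]
  simpa using h''

end Duplicate

/-! ### Solutions and certificates -/

section Certificate

variable {V : Type*} [Finite V] {G : Digraph V} {β r k α c : ℕ}

/-- A small set is part of the range of a finite sequence; the rest of the sequence consists of
copies of a given element. -/
theorem exists_range_of_ncard_le {X : Type*} [Finite X] (T : Set X) (h : T.ncard ≤ r) (d : X) :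
    ∃ f : Fin r → X, T ⊆ Set.range f ∧ Set.range f ⊆ insert d T := by
  obtain ⟨e⟩ : Nonempty (T ↪ Fin r) := by
    have := Fintype.ofFinite T
    refine Function.Embedding.nonempty_of_card_le ?_
    rwa [Fintype.card_fin, ← Nat.card_eq_fintype_card, Nat.card_coe_set_eq]
  refine ⟨Function.extend e Subtype.val fun _ => d, fun x hx => ⟨e ⟨x, hx⟩, ?_⟩, ?_⟩
  · rw [e.injective.extend_apply]
  · rintro _ ⟨i, rfl⟩
    by_cases h : ∃ t, e t = i
    · obtain ⟨t, rfl⟩ := h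
      rw [e.injective.extend_apply]
      exact Or.inr t.2
    · rw [Function.extend_apply' _ _ _ h]
      exact Or.inl rfl

/-- After the deletion of a set `S` of edges, every vertex is linked to a vertex of a set that
contains a vertex of every component and the ends of the edges in `S`. So a graph with `c`
components has at most `c + 2 |S|` components after the deletion. -/
theorem exists_representatives (hc : Nat.card (Component G) ≤ c) {S : Finset (V × V)}
    (hS : S.card ≤ β) (v₀ : V) :
    ∃ m : Fin (c + 2 * β) → V, ∀ y, ∃ i, Linked (Rest G S) y (m i) := by
  classical
  let T : Set V := Set.range (fun κ : Component G => κ.out) ∪ ↑(S.image Prod.fst ∪ S.image Prod.snd)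
  have hT : T.ncard ≤ c + 2 * β := by
    refine (Set.ncard_union_le _ _).trans (add_le_add ?_ ?_)
    · rw [← Set.image_univ]
      refine (Set.ncard_image_le).trans ?_
      rwa [Set.ncard_univ]
    · rw [Set.ncard_coe_finset]
      refine (Finset.card_union_le _ _).trans ?_
      have h1 : (S.image Prod.fst).card ≤ _ := Finset.card_image_le
      have h2 : (S.image Prod.snd).card ≤ _ := Finset.card_image_le
      omega
  obtain ⟨m, hm, -⟩ := exists_range_of_ncard_le T hT v₀
  refine ⟨m, fun y => ?_⟩
  suffices ∃ t ∈ T, Linked (Rest G S) y t by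
    obtain ⟨t, ht, h⟩ := this
    obtain ⟨i, rfl⟩ := hm ht
    exact ⟨i, h⟩
  have hy : Linked G.Adj y (G.toSimpleGraphInclusive.connectedComponentMk y).out := by
    rw [← reachable_iff_linked, ← SimpleGraph.ConnectedComponent.eq]
    exact (Quot.out_eq _).symm
  have hκ : (G.toSimpleGraphInclusive.connectedComponentMk y).out ∈ T := Or.inl ⟨_, rfl⟩
  -- Follow the path to the representative until it meets an edge of `S`.
  generalize (G.toSimpleGraphInclusive.connectedComponentMk y).out = ρ at hy hκ
  rw [Linked] at hy
  induction hy using ReflTransGen.head_induction_on with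
  | refl => exact ⟨_, hκ, .refl⟩
  | @head x x' h _ ih =>
    obtain ⟨t, ht, hl⟩ := ih
    by_cases hx : x ∈ T
    · exact ⟨x, hx, .refl⟩
    · have hx1 : ∀ z, (x, z) ∉ S := fun z hz => hx (Or.inr (by
        simp only [Finset.coe_union, Finset.coe_image, Set.mem_union]
        exact Or.inl ⟨_, hz, rfl⟩))
      have hx2 : ∀ z, (z, x) ∉ S := fun z hz => hx (Or.inr (by
        simp only [Finset.coe_union, Finset.coe_image, Set.mem_union]
        exact Or.inr ⟨_, hz, rfl⟩))
      refine ⟨t, ht, .head ?_ hl⟩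
      rcases h with h | h
      · exact Or.inl ⟨h, hx1 _⟩
      · exact Or.inr ⟨h, hx2 _⟩

/-- A certificate yields a solution: the clusters are formed by giving every component the name of
one of its representatives. -/
theorem hasSolution_of_isCertificate (hG : IsLegal G) {a b : Fin β → V} {l m : Fin r → V}
    (h : IsCertificate G k α a b l m) : HasSolution G k α β := by
  classical
  have := Fintype.ofFinite V
  let S : Finset (V × V) := Finset.univ.filter fun e =>
    G.Adj e.1 e.2 ∧ ∃ i, e.1 = a i ∧ e.2 = b i
  have hS : ∀ e ∈ S, G.Adj e.1 e.2 := fun e he => (Finset.mem_filter.1 he).2.1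
  have hU : Uncut G a b = Rest G S := by
    funext x y
    simp only [Uncut, Rest, S, Finset.mem_filter, Finset.mem_univ, true_and, eq_iff_iff]
    exact and_congr_right fun h => by simp [h]
  obtain ⟨h1, h2, h3, h4⟩ := h
  have hm : ∀ κ : Component (duplicate G S), ∃ i, κ = comp G S (m i) := by
    intro κ
    obtain ⟨v, rfl⟩ := exists_eq_comp κ
    obtain ⟨i, hi⟩ := h3 v
    exact ⟨i, comp_eq_comp.2 (hU ▸ hi)⟩
  -- Every component gets the cluster of one of its representatives.
  choose f hf using hm
  refine ⟨S, hS, ?_, ?_, (Setoid.ker (l ∘ f)).classes, Setoid.isPartition_classes _, ?_, ?_⟩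
  · have : S ⊆ Finset.univ.image fun i => (a i, b i) := by
      intro e he
      obtain ⟨i, hi⟩ := (Finset.mem_filter.1 he).2.2
      exact Finset.mem_image.2 ⟨i, by simp, Prod.ext hi.1.symm hi.2.symm⟩
    refine (Finset.card_le_card this).trans (Finset.card_image_le.trans ?_)
    simp
  · intro κ
    obtain ⟨v, rfl⟩ := exists_eq_comp κ
    obtain ⟨y, z, g1, g2, g3, g4⟩ := h4 v
    rw [hU] at g1 g4
    exact ⟨y, mem_inputs_iff.2 g2, z, mem_outputs_iff.2 g3, (comp_eq_comp.2 g1).symm,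
      reflTransGen_duplicate.2 g4⟩
  · have hsub : (Setoid.ker (l ∘ f)).classes ⊆
        (fun p : V × V => {κ | l (f κ) = p.1}) '' {p : V × V | p.1 = p.2 ∧ ∃ i, p.1 = l i} := by
      rintro _ ⟨κ, rfl⟩
      exact ⟨(l (f κ), l (f κ)), ⟨rfl, _, rfl⟩, rfl⟩
    exact (Set.ncard_le_ncard hsub (Set.toFinite _)).trans ((Set.ncard_image_le).trans h1)
  · rintro _ ⟨κ, rfl⟩
    refine ⟨ncard_inputs_eq_ncard_outputs hS hG _, ?_⟩
    rw [ncard_inputs_cluster hS]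
    refine le_trans (Set.ncard_le_ncard ?_ (Set.toFinite _)) (h2 (f κ))
    rintro p ⟨hp, h⟩
    refine ⟨⟨f (comp G S p.2), Eq.symm hp, ?_⟩, h.imp id fun h => ⟨hS p h, ?_⟩⟩
    · rw [hU]
      exact comp_eq_comp.1 (hf _)
    · rw [hU]
      exact fun hr => hr.2 h

/-- A solution yields a certificate: the name of a cluster is one of its vertices. -/
theorem exists_isCertificate (hG : IsLegal G) (hc : Nat.card (Component G) ≤ c)
    (h : HasSolution G k α β) :
    ∃ a b l m, IsCertificate (β := β) (r := c + 2 * β) G k α a b l m := by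
  classical
  obtain ⟨S, hS, hcard, hacc, P, hP, hα, hk⟩ := h
  obtain ⟨v₀, -⟩ := hG.edges_nonempty
  have hv₀ : ¬ G.Adj v₀ v₀ := fun h => hG.isDag v₀ (.single h)
  -- The sequence of edges is filled up with the loop at `v₀`, which is not an edge.
  obtain ⟨e, he1, he2⟩ := exists_range_of_ncard_le (S : Set (V × V)) (by simpa using hcard) (v₀, v₀)
  obtain ⟨m, hm⟩ := exists_representatives hc hcard v₀
  have hU : Uncut G (fun i => (e i).1) (fun i => (e i).2) = Rest G S := by
    funext x y
    refine propext (and_congr_right fun hxy => not_congr ⟨?_, fun h => ?_⟩)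
    · rintro ⟨i, hi⟩
      have hi : e i = (x, y) := Prod.ext hi.1.symm hi.2.symm
      rcases he2 ⟨i, rfl⟩ with h | h <;> rw [hi] at h
      · simp only [Prod.mk.injEq] at h
        rw [h.1, h.2] at hxy
        exact absurd hxy hv₀
      · exact h
    · obtain ⟨i, hi⟩ := he1 h
      exact ⟨i, by simp [hi], by simp [hi]⟩
  choose cl hcl huniq using hP.2
  simp only [and_imp] at huniq
  have hname : ∀ C : Set (Component (duplicate G S)), ∃ v, C ∈ P → comp G S v ∈ C := by
    intro C
    by_cases hC : C.Nonempty
    · obtain ⟨κ, hκ⟩ := hC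
      obtain ⟨v, rfl⟩ := exists_eq_comp κ
      exact ⟨v, fun _ => hκ⟩
    · rw [Set.not_nonempty_iff_eq_empty] at hC
      exact ⟨v₀, fun h => absurd (hC ▸ h) hP.1⟩
  choose name hname using hname
  have hname_inj : ∀ C ∈ P, ∀ D ∈ P, name C = name D → C = D := fun C hC D hD h =>
    (huniq _ C hC (hname C hC)).trans (huniq _ D hD (h ▸ hname D hD)).symm
  refine ⟨fun i => (e i).1, fun i => (e i).2, fun i => name (cl (comp G S (m i))), m,
    ?_, ?_, ?_, ?_⟩
  · have hsub : {p : V × V | p.1 = p.2 ∧ ∃ i, p.1 = name (cl (comp G S (m i)))} ⊆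
        (fun C => (name C, name C)) '' P := by
      rintro ⟨x, y⟩ ⟨hxy, i, hx⟩
      exact ⟨_, (hcl _).1, Prod.ext hx.symm (hx.symm.trans hxy)⟩
    exact (Set.ncard_le_ncard hsub (Set.toFinite _)).trans
      ((Set.ncard_image_le (Set.toFinite _)).trans hα)
  · intro i
    have h := (hk _ (hcl (comp G S (m i))).1).2
    rw [ncard_inputs_cluster hS] at h
    refine le_trans (Set.ncard_le_ncard ?_ (Set.toFinite _)) h
    rintro p ⟨⟨j, hj, hl⟩, hp⟩
    rw [hU] at hl hp
    refine ⟨?_, hp.imp id fun hp => ?_⟩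
    · rw [comp_eq_comp.2 hl, hname_inj _ (hcl _).1 _ (hcl _).1 hj]
      exact (hcl _).2
    · by_contra hpS
      exact hp.2 ⟨hp.1, hpS⟩
  · rw [hU]
    exact hm
  · intro x
    obtain ⟨y, hy, z, hz, hxy, hyz⟩ := hacc (comp G S x)
    rw [hU]
    exact ⟨y, z, (comp_eq_comp.1 hxy).symm, mem_inputs_iff.1 hy, mem_outputs_iff.1 hz,
      reflTransGen_duplicate.1 hyz⟩

end Certificate

end GraphDuplication

namespace GraphDuplication

/-- With at most `c` components, `c + 2 * β` representatives suffice for a certificate. -/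
theorem polyTimeDecidableOn_of_card_component_le {D : Instance → Prop} (β c : ℕ)
    (hD : ∀ I, D I → Nat.card (Component I.G) ≤ c) :
    PolyTimeDecidableOn D fun I => HasSolution I.G I.k I.α β := by
  refine polyTimeDecidableOn_of_cmd (X := Vr β (c + 2 * β)) (M := Mt (c + 2 * β)) searchCmd
    (.rel .res .x .x) (adj := .adj) (mk := .k) (ma := .α) (by simp) (by simp) (by simp) ?_
  intro I hI v A hadj hk hα
  rw [eval_searchCmd v A hadj hk hα]
  exact ⟨fun ⟨a, b, l, m, h⟩ => hasSolution_of_isCertificate I.legal h,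
    fun h => exists_isCertificate I.legal (hD I hI) h⟩

end GraphDuplication

theorem theorem2 :
    (∀ β : ℕ, GraphDuplication.PolyTimeDecidableOn
      (fun I => GraphDuplication.IsConnected I.G)
      (fun I => GraphDuplication.HasSolution I.G I.k I.α β)) ∧
    (∀ β c : ℕ, GraphDuplication.PolyTimeDecidableOn
      (fun I => Nat.card (GraphDuplication.Component I.G) ≤ c)
      (fun I => GraphDuplication.HasSolution I.G I.k I.α β)) := by
  refine ⟨fun β => ?_, fun β c => ?_⟩
  · refine GraphDuplication.polyTimeDecidableOn_of_card_component_le β 1 fun I hI => ?_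
    have := hI.preconnected.subsingleton_connectedComponent
    exact Finite.card_le_one_iff_subsingleton.2 this
  · exact GraphDuplication.polyTimeDecidableOn_of_card_component_le β c fun I hI => hI
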